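/- Let $\mathbb D=\{z\in\mathbb C:|z|<1\}$. Let $S_H$ be the class of univalent, sense-preserving harmonic functions $F=h+\overline g$ in $\mathbb D$, where $h,g$ are analytic in $\mathbb D$ with $h(0)=g(0)=0$, $h'(0)=1$ and $|h'|^2-|g'|^2>0$ in $\mathbb D$; let $S_H^0$ be the subclass of those with $F_{\bar z}(0)=\overline{g'(0)}=0$. A function $F$ on $\mathbb D$ is convex in the direction $\psi\in\mathbb R$ if every line parallel to the line through $0$ and $e^{i\psi}$ has empty or connected intersection with $F(\mathbb D)$. For analytic $p(z)=\sum a_kz^k$ and $q(z)=\sum c_kz^k$ in $\mathbb D$ put $(p*q)(z)=\sum a_kc_kz^k$, and for harmonic mappings $h+\overline g$, $r+\overline s$ (with $h,g,r,s$ analytic in $\mathbb D$ and vanishing at $0$) put $(h+\overline g)\,\tilde*\,(r+\overline s)=h*r+\overline{g*s}$. **Theorem.** Let $n\ge 1$ be an integer, let $\alpha,\gamma,\eta,\theta\in\mathbb R$ and $b\in\left(-1,-\frac{n-2}{n+2}\right]$. Let $f_{b,\alpha}=h+\overline g$, with $h,g$ analytic in $\mathbb D$ and $h(0)=g(0)=0$,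 be given by $$h(z)-e^{-2i\alpha}g(z)=\frac{z}{1-ze^{i\alpha}},\qquad \frac{g'(z)}{h'(z)}=e^{2i\alpha}\,\frac{b+ze^{i\alpha}}{1+bze^{i\alpha}},$$ and let $t_{\eta,\gamma}=r+\overline s$, with $r,s$ analytic in $\mathbb D$ and $r(0)=s(0)=0$, be given by $$r(z)-e^{-2i\gamma}s(z)=f(z),\qquad \frac{s'(z)}{r'(z)}=e^{i\theta}z^n,$$ where $f$ is analytic in $\mathbb D$ with $$zf'(z)=\frac{z}{(1+ze^{i(\eta+\gamma)})(1+ze^{-i(\eta-\gamma)})}.$$ Then $(1-b)\,\bigl(f_{b,\alpha}\,\tilde*\,t_{\eta,\gamma}\bigr)\in S_H$ (so $f_{b,\alpha}\,\tilde*\,t_{\eta,\gamma}$ itself is harmonic, univalent and sense-preserving and lies in $S_H$ up to the normalizing factor $1-b>0$), and $f_{b,\alpha}\,\tilde*\,t_{\eta,\gamma}$ is convex in the direction $-(\alpha+\gamma)$. **Special case.** Let $n\in\{1,2\}$, $\theta\in\mathbb R$ and $\pi/2\le\psi<\pi$. Let $f_c=h_c+\overline{g_c}$ and $f_n=h_n+\overline{g_n}$,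 with $h_c,g_c,h_n,g_n$ analytic in $\mathbb D$ and vanishing at $0$, be given by $$h_c(z)-g_c(z)=\frac z{1-z},\quad \frac{g_c'(z)}{h_c'(z)}=z;\qquad h_n(z)-g_n(z)=\frac1{2i\sin\psi}\log\left(\frac{1+ze^{i\psi}}{1+ze^{-i\psi}}\right),\quad \frac{g_n'(z)}{h_n'(z)}=e^{i\theta}z^n,$$ with the principal branch of the logarithm. Then $f_c\,\tilde*\,f_n\in S_H^0$ and is convex in the direction of the real axis. -/

import Mathlib

open Complex Set InnerProductSpace
open scoped ComplexConjugate

noncomputable section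

/-- The open unit disc in the complex plane. -/
abbrev unitDisc : Set ℂ := Metric.ball (0 : ℂ) 1

/-- The complex-valued function `h + conj g`. -/
def harmonicSum (h g : ℂ → ℂ) : ℂ → ℂ := fun z => h z + conj (g z)

/-- `n`-th Taylor coefficient at the origin. -/
def taylorCoeff (f : ℂ → ℂ) (n : ℕ) : ℂ := iteratedDeriv n f 0 / (n.factorial : ℂ)

/-- Hadamard product of two functions analytic in the unit disc: the power series whose
coefficients are the products of the Taylor coefficients (it converges in the whole disc). -/
def hadamardProd (f F : ℂ → ℂ) : ℂ → ℂ :=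
  fun z => ∑' n : ℕ, taylorCoeff f n * taylorCoeff F n * z ^ n

/-- Convolution `h * H + conj (g * G)` of the harmonic mappings `h + conj g` and `H + conj G`. -/
def harmonicConv (h g H G : ℂ → ℂ) : ℂ → ℂ :=
  harmonicSum (hadamardProd h H) (hadamardProd g G)

/-- `f` is a univalent, sense-preserving harmonic function in the unit disc with canonical
representation `f = h + conj g`, normalized by `h 0 = g 0 = 0` and `h' 0 = 1`. -/
structure IsNormalizedUnivalentHarmonic (f h g : ℂ → ℂ) : Prop where
  harmonic : HarmonicOnNhd f unitDisc
  univalent : InjOn f unitDisc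
  analytic_h : DifferentiableOn ℂ h unitDisc
  analytic_g : DifferentiableOn ℂ g unitDisc
  rep : EqOn f (harmonicSum h g) unitDisc
  h_zero : h 0 = 0
  g_zero : g 0 = 0
  deriv_h_zero : deriv h 0 = 1
  /-- The Jacobian `|h'|² - |g'|²` is positive. -/
  jacobian_pos : ∀ z ∈ unitDisc, 0 < ‖deriv h z‖ ^ 2 - ‖deriv g z‖ ^ 2

/-- The class `S_H`. -/
def classSH : Set (ℂ → ℂ) :=
  {f | ∃ h g : ℂ → ℂ, IsNormalizedUnivalentHarmonic f h g}

/-- The class `S_H^0`: those `f = h + conj g` in `S_H` whose derivative with respect to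
`conj z`, which is `conj (g' z)`, vanishes at the origin. -/
def classSHZero : Set (ℂ → ℂ) :=
  {f | ∃ h g : ℂ → ℂ, IsNormalizedUnivalentHarmonic f h g ∧ deriv g 0 = 0}

/-- `E` is convex in the direction `ψ`: every line parallel to the line through `0` and
`e^{iψ}` has empty or connected intersection with `E`. -/
def SetConvexInDirection (E : Set ℂ) (ψ : ℝ) : Prop :=
  ∀ p : ℂ, IsPreconnected (E ∩ {w | ∃ t : ℝ, w = p + (t : ℂ) * exp (ψ * I)})

/-- `f` maps the unit disc onto a set convex in the direction `ψ`. -/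
def ConvexInDirection (f : ℂ → ℂ) (ψ : ℝ) : Prop :=
  SetConvexInDirection (f '' unitDisc) ψ

/-- `h + conj g` is a harmonic mapping of the unit disc, `h` and `g` analytic and vanishing at `0`,
with `h - e^{-2iα} g = k` and dilatation `g' / h' = w`, written as `g' = w h'`. -/
structure IsShear (h g : ℂ → ℂ) (α : ℝ) (k w : ℂ → ℂ) : Prop where
  analytic_h : DifferentiableOn ℂ h unitDisc
  analytic_g : DifferentiableOn ℂ g unitDisc
  h_zero : h 0 = 0
  g_zero : g 0 = 0
  diff_eq : ∀ z ∈ unitDisc, h z - exp (-2 * α * I) * g z = k z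
  dilatation : ∀ z ∈ unitDisc, deriv g z = w z * deriv h z

/-- `h + conj g` is the mapping `f_{b,α}`. -/
def IsFMap (b α : ℝ) (h g : ℂ → ℂ) : Prop :=
  IsShear h g α (fun z => z / (1 - z * exp (α * I)))
    (fun z => exp (2 * α * I) * ((b + z * exp (α * I)) / (1 + b * z * exp (α * I))))

/-- `r + conj s` is a mapping `t_{η,γ}`, with dilatation `e^{iθ} z^n`. -/
def IsTMap (η γ θ : ℝ) (n : ℕ) (r s : ℂ → ℂ) : Prop :=
  ∃ f : ℂ → ℂ, DifferentiableOn ℂ f unitDisc ∧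
    (∀ z ∈ unitDisc, z * deriv f z =
      z / ((1 + z * exp ((η + γ) * I)) * (1 + z * exp (-(η - γ) * I)))) ∧
    IsShear r s γ f (fun z => exp (θ * I) * z ^ n)

end

open Filter Topology

/-! Put β = (1 + b)/2 and a = e^{iα}. Both analytic parts of f_{b,α} combine the half-plane map z/(1
- za) and the Koebe-type map z/(1 - za)², so for m ≥ 1 their coefficients are, up to constant
factors, aᵐ(βm ± (1 - β)). Convolution with f_{b,α} is therefore a first order differential
operator. After rotations and scaling by 1 - b the mapping becomes H + conj G with H = βvR' + (1 -
β)R and G = βvS' - (1 - β)S, where R' - S' = 1/Q, Q = 1 + 2v cos η + v², S' = ζR' and ζ = cvⁿ with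
|c| = 1.

The Jacobian: the logarithmic derivative of R' gives H' = R'(k + βP) and G' = ζR'(-k + βP), with k =
1 - β(1 + n/2) and P = (1 - v²)/Q + (n/2)(1 + ζ)/(1 - ζ). Since Re P > 0 and |ζ| < 1, k ≥ 0 implies
|G'| < |H'|, and k ≥ 0 is precisely the upper bound on b (`norm_deriv_convG_lt`).

Univalence and convexity use the shear principle of Clunie and Sheil-Small. The function (H' - G')Q
= β(1 - v²)/Q + (1 - β)(1 + ζ)/(1 - ζ) has positive real part. A coordinate w with dv/dw = mQ, m >
0, turns the disc into a vertical strip or half-plane (`exists_isStripParam`), and there φ = H - G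
satisfies Re φ' > 0. So φ is injective and Im φ increases along vertical lines; it runs from -∞ to
∞, because φ = βv/Q + (1 - β)(R + S), where Im(v/Q) is unbounded both ways and Im(R + S) is
monotone. Each level set of Im φ is thus a connected curve. As Im(H + conj G) = Im φ and Re(H + G)
increases with Re φ on such a curve, H + conj G is injective with connected horizontal sections
(`shear_strip`). -/

/-! ### Positive real part of the derivative, and the shear principle. -/

lemma hasDerivAt_im_vertical {f f' : ℂ → ℂ} {x y : ℝ}
    (hf : HasDerivAt f (f' (x + y * I)) (x + y * I)) :
    HasDerivAt (fun t : ℝ => (f (x + t * I)).im) (f' (x + y * I)).re y := by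
  have h1 : HasDerivAt (fun t : ℝ => (x + t * I : ℂ)) I y := by
    simpa using ((hasDerivAt_id y).ofReal_comp.mul_const I).const_add (x : ℂ)
  have h2 := hf.comp (h := fun t : ℝ => (x + t * I : ℂ)) y h1
  have h3 := imCLM.hasFDerivAt.comp_hasDerivAt y h2
  have h4 : imCLM (f' (x + y * I) * I) = (f' (x + y * I)).re := by simp
  rw [h4] at h3
  exact h3

lemma monotone_im_vertical {f f' : ℂ → ℂ} {x : ℝ}
    (hf : ∀ y : ℝ, HasDerivAt f (f' (x + y * I)) (x + y * I))
    (hpos : ∀ y : ℝ, 0 ≤ (f' (x + y * I)).re) :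
    Monotone (fun y : ℝ => (f (x + y * I)).im) :=
  monotone_of_hasDerivAt_nonneg (fun y => hasDerivAt_im_vertical (hf y)) hpos

lemma strictMono_im_vertical {f f' : ℂ → ℂ} {x : ℝ}
    (hf : ∀ y : ℝ, HasDerivAt f (f' (x + y * I)) (x + y * I))
    (hpos : ∀ y : ℝ, 0 < (f' (x + y * I)).re) :
    StrictMono (fun y : ℝ => (f (x + y * I)).im) :=
  strictMono_of_hasDerivAt_pos (fun y => hasDerivAt_im_vertical (hf y)) hpos

/-- The Noshiro–Warschawski theorem. -/
lemma injOn_of_re_deriv_pos {S : Set ℂ} (hS : Convex ℝ S) {f f' : ℂ → ℂ}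
    (hf : ∀ w ∈ S, HasDerivAt f (f' w) w) (hpos : ∀ w ∈ S, 0 < (f' w).re) : InjOn f S := by
  intro a ha b hb hab
  by_contra hne
  have hd : b - a ≠ 0 := sub_ne_zero.2 (Ne.symm hne)
  have hmem : ∀ t ∈ Icc (0 : ℝ) 1, a + t * (b - a) ∈ S := by
    intro t ht
    have := hS.add_smul_sub_mem ha hb ht
    simpa using this
  have hder : ∀ t ∈ Icc (0 : ℝ) 1,
      HasDerivAt (fun t : ℝ => (conj (b - a) * f (a + t * (b - a))).re)
        (conj (b - a) * (f' (a + t * (b - a)) * (b - a))).re t := by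
    intro t ht
    have h1 : HasDerivAt (fun t : ℝ => a + t * (b - a)) (b - a) t := by
      simpa using ((hasDerivAt_id t).ofReal_comp.mul_const (b - a)).const_add a
    have h2 := ((hf _ (hmem t ht)).comp (h := fun t : ℝ => a + t * (b - a)) t h1).const_mul
      (conj (b - a))
    exact reCLM.hasFDerivAt.comp_hasDerivAt t h2
  have hmono : StrictMonoOn (fun t : ℝ => (conj (b - a) * f (a + t * (b - a))).re)
      (Icc 0 1) := by
    refine strictMonoOn_of_deriv_pos (convex_Icc 0 1)
      (fun t ht => (hder t ht).continuousAt.continuousWithinAt) fun t ht => ?_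
    rw [interior_Icc] at ht
    have ht' : t ∈ Icc (0 : ℝ) 1 := ⟨ht.1.le, ht.2.le⟩
    rw [(hder t ht').deriv]
    have : conj (b - a) * (f' (a + t * (b - a)) * (b - a))
        = ((normSq (b - a) : ℝ) : ℂ) * f' (a + t * (b - a)) := by
      rw [normSq_eq_conj_mul_self]; ring
    rw [this, re_ofReal_mul]
    exact mul_pos (normSq_pos.2 hd) (hpos _ (hmem t ht'))
  have := hmono (left_mem_Icc.2 zero_le_one) (right_mem_Icc.2 zero_le_one) zero_lt_one
  simp [hab] at this

/-- The real part of (a + b)·conj(a - b) is |a|² - |b|². This serves both the Jacobian condition and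
(1 + ζ)/(1 - ζ). -/
lemma re_add_div_sub_pos {a b : ℂ} (h : ‖b‖ < ‖a‖) : 0 < ((a + b) / (a - b)).re := by
  have hne : a - b ≠ 0 := by
    intro h0
    rw [sub_eq_zero.1 h0] at h
    exact lt_irrefl _ h
  have hn : 0 < normSq (a - b) := normSq_pos.2 hne
  have h2 : normSq b < normSq a := by
    rw [normSq_eq_norm_sq, normSq_eq_norm_sq]
    gcongr
  rw [div_re, ← add_div]
  apply div_pos _ hn
  rw [normSq_apply, normSq_apply] at h2
  simp only [add_re, sub_re, add_im, sub_im]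
  linarith

/-- An implicit function theorem from monotonicity alone: the strict inequalities at Y x ± ε persist
for nearby x and trap the root. It makes level sets of Im φ continuous graphs over `J`. -/
lemma continuousOn_of_isRoot_strictMono {J : Set ℝ} (hI : IsOpen J) {u : ℝ → ℝ → ℝ}
    (hmono : ∀ x ∈ J, StrictMono (u x)) (hcont : ∀ y, ContinuousOn (fun x => u x y) J)
    {c : ℝ} {Y : ℝ → ℝ} (hY : ∀ x ∈ J, u x (Y x) = c) : ContinuousOn Y J := by
  intro x hx
  refine ContinuousAt.continuousWithinAt ?_
  rw [Metric.continuousAt_iff']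
  intro ε hε
  have h1 : u x (Y x - ε) < c := (hY x hx) ▸ hmono x hx (by linarith)
  have h2 : c < u x (Y x + ε) := by
    conv_lhs => rw [← hY x hx]
    exact hmono x hx (by linarith)
  have hn := hI.mem_nhds hx
  filter_upwards [((hcont (Y x - ε)).continuousAt hn).eventually_lt_const h1,
    ((hcont (Y x + ε)).continuousAt hn).eventually_const_lt h2, hn] with z hz1 hz2 hzI
  rw [← hY z hzI] at hz1 hz2
  have h3 := (hmono z hzI).lt_iff_lt.1 hz1
  have h4 := (hmono z hzI).lt_iff_lt.1 hz2
  rw [Real.dist_eq, abs_lt]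
  constructor <;> linarith

/-- The shear construction on a vertical strip (or half-plane) `{w | re w ∈ J}`. -/
theorem shear_strip {J : Set ℝ} (hI : IsOpen J) (hIc : OrdConnected J) {H G H' G' : ℂ → ℂ}
    (hH : ∀ w : ℂ, w.re ∈ J → HasDerivAt H (H' w) w)
    (hG : ∀ w : ℂ, w.re ∈ J → HasDerivAt G (G' w) w)
    (hpos : ∀ w : ℂ, w.re ∈ J → 0 < (H' w - G' w).re)
    (hjac : ∀ w : ℂ, w.re ∈ J → ‖G' w‖ < ‖H' w‖)
    (htop : ∀ x ∈ J, Tendsto (fun y : ℝ => (H (x + y * I) - G (x + y * I)).im) atTop atTop)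
    (hbot : ∀ x ∈ J, Tendsto (fun y : ℝ => (H (x + y * I) - G (x + y * I)).im) atBot atBot) :
    InjOn (harmonicSum H G) (re ⁻¹' J) ∧
      ∀ c : ℝ, IsPreconnected (harmonicSum H G '' (re ⁻¹' J) ∩ {w | w.im = c}) := by
  set S : Set ℂ := re ⁻¹' J with hS
  have hSo : IsOpen S := hI.preimage continuous_re
  have hSc : Convex ℝ S := hIc.convex.linear_preimage reLm
  set φ : ℂ → ℂ := fun w => H w - G w with hφ
  have hφd : ∀ w ∈ S, HasDerivAt φ (H' w - G' w) w := fun w hw => (hH w hw).sub (hG w hw)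
  have hinj : InjOn φ S := injOn_of_re_deriv_pos hSc hφd hpos
  have hmem : ∀ x ∈ J, ∀ y : ℝ, (x + y * I : ℂ) ∈ S := by
    intro x hx y; simpa [hS] using hx
  have hmono : ∀ x ∈ J, StrictMono (fun y : ℝ => (φ (x + y * I)).im) := fun x hx =>
    strictMono_im_vertical (f' := fun w => H' w - G' w) (fun y => hφd _ (hmem x hx y))
      (fun y => hpos _ (hmem x hx y))
  have hφc : ContinuousOn φ S := fun w hw => (hφd w hw).continuousAt.continuousWithinAt
  have hex : ∀ c : ℝ, ∃ Y : ℝ → ℝ, ∀ x ∈ J, (φ (x + Y x * I)).im = c := by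
    intro c
    have : ∀ x : ℝ, ∃ y : ℝ, x ∈ J → (φ (x + y * I)).im = c := by
      intro x
      by_cases hx : x ∈ J
      · have hcont : Continuous (fun y : ℝ => (φ (x + y * I)).im) := by
          refine continuous_im.comp (hφc.comp_continuous (by fun_prop) (hmem x hx))
        obtain ⟨y, hy⟩ := hcont.surjective (htop x hx) (hbot x hx) c
        exact ⟨y, fun _ => hy⟩
      · exact ⟨0, fun h => absurd h hx⟩
    choose Y hY using this
    exact ⟨Y, hY⟩
  set θ := Function.invFunOn φ S with hθ
  have hθl : ∀ w ∈ S, θ (φ w) = w := fun w hw => hinj.leftInvOn_invFunOn hw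
  have hθd : ∀ w ∈ S, HasDerivAt θ (H' w - G' w)⁻¹ (φ w) := by
    intro w hw
    have hne : H' w - G' w ≠ 0 := by
      intro h0
      have := hpos w hw
      rw [h0] at this
      simp at this
    have hst : HasStrictDerivAt φ (H' w - G' w) w := by
      have hdo : DifferentiableOn ℂ φ S := fun z hz =>
        (hφd z hz).differentiableAt.differentiableWithinAt
      have := (hdo.analyticAt (hSo.mem_nhds hw)).hasStrictDerivAt
      rwa [(hφd w hw).deriv] at this
    exact (hst.to_local_left_inverse hne
      (by filter_upwards [hSo.mem_nhds hw] with z hz using hθl z hz)).hasDerivAt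
  have hFim : ∀ w, (harmonicSum H G w).im = (φ w).im := by
    intro w; simp [harmonicSum, hφ, sub_eq_add_neg]
  have hFre : ∀ w, (harmonicSum H G w).re = (H w + G w).re := by
    intro w; simp [harmonicSum]
  -- the level sets of `im φ`
  have key : ∀ c : ℝ, ∃ γ : ℝ → ℂ, ContinuousOn γ J ∧ (∀ x ∈ J, γ x ∈ S) ∧
      (∀ w ∈ S, (φ w).im = c ↔ ∃ x ∈ J, γ x = w) := by
    intro c
    obtain ⟨Y, hY⟩ := hex c
    have hYc : ContinuousOn Y J := by
      refine continuousOn_of_isRoot_strictMono hI (u := fun x y => (φ (x + y * I)).im)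
        hmono (fun y => ?_) hY
      exact continuous_im.comp_continuousOn
        (hφc.comp (by fun_prop) (fun x hx => hmem x hx y))
    refine ⟨fun x => x + Y x * I, ?_, fun x hx => hmem x hx _, ?_⟩
    · have : ContinuousOn (fun x => ((Y x : ℝ) : ℂ)) J := continuous_ofReal.comp_continuousOn hYc
      fun_prop
    · intro w hw
      constructor
      · intro h
        refine ⟨w.re, hw, ?_⟩
        have : Y w.re = w.im := (hmono _ hw).injective (by
          simp only [hY _ hw, re_add_im, h])
        simp [this]
      · rintro ⟨x, hx, rfl⟩
        exact hY x hx
  refine ⟨?_, ?_⟩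
  · intro a ha b hb hab
    obtain ⟨γ, hγc, hγS, hγ⟩ := key (φ a).im
    set c := (φ a).im with hc
    have hbc : (φ b).im = c := by rw [← hFim, ← hab, hFim]
    -- The level curve is connected, so φ maps it onto a horizontal interval at height c,
    -- parametrized by T.
    set T : Set ℝ := (fun x => (φ (γ x)).re) '' J with hT
    have hTc : OrdConnected T := by
      refine (IsPreconnected.image hIc.isPreconnected _ ?_).ordConnected
      exact continuous_re.comp_continuousOn (hφc.comp hγc hγS)
    have hTm : ∀ t ∈ T, ∃ w ∈ S, φ w = t + c * I := by
      rintro _ ⟨x, hx, rfl⟩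
      refine ⟨γ x, hγS x hx, ?_⟩
      rw [← (hγ _ (hγS x hx)).2 ⟨x, hx, rfl⟩, re_add_im]
    -- With Re φ as parameter on the level curve, Re(H + G) has derivative Re((H' + G')/(H' - G')),
    -- positive because |G'| < |H'|.
    have hder : ∀ t ∈ T, ∃ d : ℝ, 0 < d ∧ HasDerivAt
        (fun t : ℝ => (H (θ (t + c * I)) + G (θ (t + c * I))).re) d t := by
      intro t ht
      obtain ⟨w, hw, hwt⟩ := hTm t ht
      refine ⟨((H' w + G' w) * (H' w - G' w)⁻¹).re, ?_, ?_⟩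
      · rw [← div_eq_mul_inv]
        exact re_add_div_sub_pos (hjac w hw)
      · have h1 : HasDerivAt (fun t : ℝ => (t + c * I : ℂ)) 1 t := by
          simpa using (hasDerivAt_id t).ofReal_comp.add_const (c * I)
        have h2 : HasDerivAt θ (H' w - G' w)⁻¹ (t + c * I) := hwt ▸ hθd w hw
        have h3 : HasDerivAt (fun z => H z + G z) (H' w + G' w) (θ (t + c * I)) := by
          rw [← hwt, hθl w hw]
          exact (hH w hw).add (hG w hw)
        have h4 := h3.comp t (h2.comp (h := fun t : ℝ => (t + c * I : ℂ)) t h1)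
        rw [mul_one] at h4
        exact reCLM.hasFDerivAt.comp_hasDerivAt t h4
    have hsm : StrictMonoOn
        (fun t : ℝ => (H (θ (t + c * I)) + G (θ (t + c * I))).re) T := by
      refine strictMonoOn_of_deriv_pos hTc.convex (fun t ht => ?_) (fun t ht => ?_)
      · obtain ⟨d, -, hd⟩ := hder t ht
        exact hd.continuousAt.continuousWithinAt
      · obtain ⟨d, hd0, hd⟩ := hder t (interior_subset ht)
        rw [hd.deriv]; exact hd0
    have hval : ∀ w ∈ S, (φ w).im = c → (φ w).re ∈ T ∧ θ ((φ w).re + c * I) = w := by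
      intro w hw hwc
      refine ⟨?_, ?_⟩
      · obtain ⟨x, hx, hxw⟩ := (hγ w hw).1 hwc
        exact ⟨x, hx, by simp [hxw]⟩
      · rw [← hwc, re_add_im, hθl w hw]
    obtain ⟨ha1, ha2⟩ := hval a ha rfl
    obtain ⟨hb1, hb2⟩ := hval b hb hbc
    have : (φ a).re = (φ b).re := by
      refine hsm.injOn ha1 hb1 ?_
      simp only [ha2, hb2]
      rw [← hFre, ← hFre, hab]
    rw [← ha2, ← hb2, this]
  · intro c
    obtain ⟨γ, hγc, hγS, hγ⟩ := key c
    have : harmonicSum H G '' S ∩ {w | w.im = c} = (fun x => harmonicSum H G (γ x)) '' J := by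
      ext z
      constructor
      · rintro ⟨⟨w, hw, rfl⟩, hz⟩
        rw [mem_ofPred_eq, hFim] at hz
        obtain ⟨x, hx, rfl⟩ := (hγ w hw).1 hz
        exact ⟨x, hx, rfl⟩
      · rintro ⟨x, hx, rfl⟩
        refine ⟨⟨γ x, hγS x hx, rfl⟩, ?_⟩
        rw [mem_ofPred_eq, hFim]
        exact (hγ _ (hγS x hx)).2 ⟨x, hx, rfl⟩
    rw [this]
    refine hIc.isPreconnected.image _ ?_
    have hHc : ContinuousOn H S := fun w hw => (hH w hw).continuousAt.continuousWithinAt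
    have hGc : ContinuousOn G S := fun w hw => (hG w hw).continuousAt.continuousWithinAt
    exact (hHc.comp hγc hγS).add (continuous_conj.comp_continuousOn (hGc.comp hγc hγS))

/-! ### Strip and half-plane coordinates on the disc. -/

/-- `κ` parametrizes the unit disc by the strip `{w | re w ∈ J}` so that the flow lines of
`1 + 2 C v + v²` become vertical lines. -/
structure IsStripParam (C : ℝ) (J : Set ℝ) (κ : ℂ → ℂ) (m : ℝ) : Prop where
  isOpen : IsOpen J
  ordConnected : OrdConnected J
  pos : 0 < m
  norm_lt : ∀ w : ℂ, w.re ∈ J → ‖κ w‖ < 1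
  hasDerivAt : ∀ w : ℂ, w.re ∈ J → HasDerivAt κ (m * (1 + 2 * C * κ w + κ w ^ 2)) w
  surj : ∀ v : ℂ, ‖v‖ < 1 → ∃ w : ℂ, w.re ∈ J ∧ κ w = v
  im_tendsto : ∀ x ∈ J, ∃ (A : ℝ) (a : ℝ → ℝ), 0 < A ∧ Tendsto a atTop atTop ∧
    Tendsto a atBot atBot ∧ ∀ y : ℝ,
      (κ (x + y * I) / (1 + 2 * C * κ (x + y * I) + κ (x + y * I) ^ 2)).im = A * a y

lemma isStripParam_neg_one : IsStripParam (-1) (Ioi (-1 / 2)) (fun w => w / (1 + w)) 1 where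
  isOpen := isOpen_Ioi
  ordConnected := ordConnected_Ioi
  pos := one_pos
  norm_lt w hw := by
    have hw : -1 / 2 < w.re := hw
    have h1 : ‖w‖ < ‖1 + w‖ := by
      rw [← sq_lt_sq₀ (norm_nonneg _) (norm_nonneg _), ← normSq_eq_norm_sq, ← normSq_eq_norm_sq,
        normSq_apply, normSq_apply]
      simp
      nlinarith
    rw [norm_div, div_lt_one ((norm_nonneg _).trans_lt h1)]
    exact h1
  hasDerivAt w hw := by
    have hne : 1 + w ≠ 0 := by
      intro h
      have hw : -1 / 2 < w.re := hw
      have := congrArg re h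
      simp at this
      linarith
    have h := (hasDerivAt_id w).div ((hasDerivAt_id w).const_add 1) hne
    refine h.congr_deriv ?_
    simp only [id]
    push_cast
    field_simp
    ring
  surj v hv := by
    have hne : 1 - v ≠ 0 := by
      intro h
      rw [← sub_eq_zero.1 h] at hv
      simp at hv
    refine ⟨v / (1 - v), ?_, ?_⟩
    · have hn : 0 < normSq (1 - v) := normSq_pos.2 hne
      have hv2 : normSq v < 1 := by
        rw [normSq_eq_norm_sq]; exact pow_lt_one₀ (norm_nonneg _) hv two_ne_zero
      simp only [mem_Ioi, div_re]
      rw [← add_div, lt_div_iff₀ hn]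
      rw [normSq_apply] at *
      simp at *
      nlinarith
    · have h1 : 1 + v / (1 - v) = 1 / (1 - v) := by field_simp; ring
      rw [h1]
      field_simp
  im_tendsto x hx := by
    have hx : -1 / 2 < x := hx
    refine ⟨2 * x + 1, id, by linarith, tendsto_id, tendsto_id, fun y => ?_⟩
    have hne : (1 + (x + y * I) : ℂ) ≠ 0 := by
      intro h
      have := congrArg re h
      simp at this
      linarith
    set w : ℂ := x + y * I with hw
    have : w / (1 + w) / (1 + 2 * ((-1 : ℝ) : ℂ) * (w / (1 + w)) + (w / (1 + w)) ^ 2)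
        = w * (1 + w) := by
      have h2 : 1 + 2 * ((-1 : ℝ) : ℂ) * (w / (1 + w)) + (w / (1 + w)) ^ 2 = 1 / (1 + w) ^ 2 := by
        push_cast
        field_simp
        ring
      rw [h2]
      field_simp
    rw [this, hw]
    simp
    ring

/-- The case C = -1 conjugated by w ↦ -w. -/
lemma isStripParam_one : IsStripParam 1 (Iio (1 / 2)) (fun w => w / (1 - w)) 1 where
  isOpen := isOpen_Iio
  ordConnected := ordConnected_Iio
  pos := one_pos
  norm_lt w hw := by
    have h := isStripParam_neg_one.norm_lt (-w) (by simp at hw ⊢; linarith)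
    rwa [neg_div, norm_neg, ← sub_eq_add_neg] at h
  hasDerivAt w hw := by
    have h := isStripParam_neg_one.hasDerivAt (-w) (by simp at hw ⊢; linarith)
    have h2 := (h.comp w (hasDerivAt_neg w)).neg
    have e : (-(fun w : ℂ => w / (1 + w)) ∘ Neg.neg) = fun w : ℂ => w / (1 - w) := by
      ext z; simp [neg_div, sub_eq_add_neg]
    rw [e] at h2
    refine h2.congr_deriv ?_
    push_cast
    rw [neg_div, ← sub_eq_add_neg]
    ring
  surj v hv := by
    obtain ⟨w, hw, hwv⟩ := isStripParam_neg_one.surj (-v) (by simpa using hv)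
    refine ⟨-w, by simp at hw ⊢; linarith, ?_⟩
    simp only [sub_neg_eq_add, neg_div, hwv, neg_neg]
  im_tendsto x hx := by
    obtain ⟨A, a, hA, h1, h2, h3⟩ :=
      isStripParam_neg_one.im_tendsto (-x) (by simp at hx ⊢; linarith)
    refine ⟨A, fun y => -a (-y), hA, tendsto_neg_atBot_atTop.comp (h2.comp tendsto_neg_atTop_atBot),
      tendsto_neg_atTop_atBot.comp (h1.comp tendsto_neg_atBot_atTop), fun y => ?_⟩
    have := h3 (-y)
    rw [mul_neg, ← this, ← neg_im]
    congr 1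
    have hz : ((-x : ℝ) : ℂ) + ((-y : ℝ) : ℂ) * I = -(x + y * I) := by push_cast; ring
    rw [hz]
    set w : ℂ := x + y * I
    rw [neg_div, ← sub_eq_add_neg]
    push_cast
    rw [neg_div, neg_neg]
    congr 1
    ring

lemma normSq_sin (w : ℂ) : normSq (sin w) = Real.sin w.re ^ 2 + Real.sinh w.im ^ 2 := by
  rw [sin_eq, ← ofReal_sin, ← ofReal_cosh, ← ofReal_cos, ← ofReal_sinh, ← ofReal_mul,
    ← ofReal_mul, normSq_add_mul_I]
  have h1 := Real.cosh_sq w.im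
  have h2 := Real.sin_sq_add_cos_sq w.re
  rw [mul_pow, mul_pow, h1]
  linear_combination Real.sinh w.im ^ 2 * h2

/-- The sinh terms of the two squared moduli agree, and sin²(η - x) - sin² x = sin η · sin(η - 2x).
Hence the modulus of sin w / sin(η - w) compares with 1 according to Re w alone. -/
lemma norm_sin_lt_iff {η : ℝ} (hη : 0 < Real.sin η) (w : ℂ) :
    ‖sin w‖ < ‖sin (η - w)‖ ↔ 0 < Real.sin (η - 2 * w.re) := by
  rw [← sq_lt_sq₀ (norm_nonneg _) (norm_nonneg _), ← normSq_eq_norm_sq, ← normSq_eq_norm_sq,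
    normSq_sin, normSq_sin]
  simp only [sub_re, ofReal_re, sub_im, ofReal_im, zero_sub, Real.sinh_neg, neg_sq]
  have h : Real.sin (η - w.re) ^ 2 - Real.sin w.re ^ 2 = Real.sin η * Real.sin (η - 2 * w.re) := by
    have e : η - 2 * w.re = (η - w.re) - w.re := by ring
    have e' : Real.sin η = Real.sin ((η - w.re) + w.re) := by ring_nf
    rw [e, e', Real.sin_add, Real.sin_sub (η - w.re)]
    have h1 := Real.sin_sq_add_cos_sq w.re
    have h2 := Real.sin_sq_add_cos_sq (η - w.re)
    linear_combination (Real.sin w.re ^ 2) * h2 - Real.sin (η - w.re) ^ 2 * h1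
  constructor
  · intro h'
    have : 0 < Real.sin η * Real.sin (η - 2 * w.re) := by linarith
    exact (mul_pos_iff_of_pos_left hη).1 this
  · intro h'
    have : 0 < Real.sin η * Real.sin (η - 2 * w.re) := mul_pos hη h'
    linarith

lemma tendsto_sinh_two_mul_atTop : Tendsto (fun y : ℝ => Real.sinh (2 * y)) atTop atTop := by
  refine tendsto_atTop_mono' _ ?_ tendsto_id
  filter_upwards [eventually_ge_atTop 0] with y hy
  have := Real.self_le_sinh_iff.2 (show 0 ≤ 2 * y by linarith)
  simp only [id]
  linarith

lemma tendsto_sinh_two_mul_atBot : Tendsto (fun y : ℝ => Real.sinh (2 * y)) atBot atBot := by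
  have := tendsto_neg_atTop_atBot.comp (tendsto_sinh_two_mul_atTop.comp tendsto_neg_atBot_atTop)
  refine this.congr fun y => ?_
  simp [Real.sinh_neg]

lemma sin_sq_add_law {η : ℝ} (w : ℂ) :
    sin (η - w) ^ 2 + 2 * cos η * sin w * sin (η - w) + sin w ^ 2 = sin η ^ 2 := by
  rw [Complex.sin_sub]
  have h1 := Complex.sin_sq_add_cos_sq w
  have h2 := Complex.sin_sq_add_cos_sq (η : ℂ)
  linear_combination (sin (η : ℂ) ^ 2) * h1 - sin w ^ 2 * h2

/-- For κ = sin w / sin(η - w) the addition law gives Q(κ) = sin² η / sin²(η - w), while κ' = sin η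
/ sin²(η - w). This explains m = 1/sin η. -/
lemma isStripParam_cos {η : ℝ} (h0 : 0 < η) (hπ : η < Real.pi) :
    IsStripParam (Real.cos η) (Ioo ((η - Real.pi) / 2) (η / 2))
      (fun w => sin w / sin (η - w)) (1 / Real.sin η) := by
  have hs : 0 < Real.sin η := Real.sin_pos_of_pos_of_lt_pi h0 hπ
  have hsc : (sin (η : ℂ)) ≠ 0 := by
    rw [← ofReal_sin]; exact_mod_cast hs.ne'
  have hJ : ∀ x : ℝ, x ∈ Ioo ((η - Real.pi) / 2) (η / 2) → 0 < Real.sin (η - 2 * x) := by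
    intro x hx
    exact Real.sin_pos_of_pos_of_lt_pi (by linarith [hx.2]) (by linarith [hx.1])
  have hn : ∀ w : ℂ, w.re ∈ Ioo ((η - Real.pi) / 2) (η / 2) → ‖sin w‖ < ‖sin (η - w)‖ :=
    fun w hw => (norm_sin_lt_iff hs w).2 (hJ _ hw)
  have hne : ∀ w : ℂ, w.re ∈ Ioo ((η - Real.pi) / 2) (η / 2) → sin (η - w) ≠ 0 := by
    intro w hw h
    have := hn w hw
    rw [h, norm_zero] at this
    exact absurd this (norm_nonneg _).not_gt
  have hq : ∀ w : ℂ, w.re ∈ Ioo ((η - Real.pi) / 2) (η / 2) →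
      1 + 2 * (Real.cos η : ℂ) * (sin w / sin (η - w)) + (sin w / sin (η - w)) ^ 2
        = sin η ^ 2 / sin (η - w) ^ 2 := by
    intro w hw
    have := hne w hw
    rw [← sin_sq_add_law w, ofReal_cos]
    field_simp
  refine ⟨isOpen_Ioo, ordConnected_Ioo, by positivity, ?_, ?_, ?_, ?_⟩
  · intro w hw
    rw [norm_div, div_lt_one ((norm_nonneg _).trans_lt (hn w hw))]
    exact hn w hw
  · intro w hw
    rw [hq w hw]
    have h1 : HasDerivAt (fun w : ℂ => sin (η - w)) (-cos (η - w)) w := by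
      simpa using ((hasDerivAt_id w).const_sub (η : ℂ)).csin
    have h := (Complex.hasDerivAt_sin w).div h1 (hne w hw)
    refine h.congr_deriv ?_
    have e : sin (η : ℂ) = sin (w + (η - w)) := by ring_nf
    have e2 : cos w * sin (η - w) - sin w * -cos (η - w) = sin (η : ℂ) := by
      rw [e, Complex.sin_add w]; ring
    rw [e2]
    push_cast
    field_simp
  · intro v hv
    have hA : ∀ t : ℝ, 1 + v * exp (t * I) ≠ 0 := by
      intro t h
      have h2 : ‖v * exp (t * I)‖ = 1 := by
        rw [eq_neg_of_add_eq_zero_right h]; simp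
      rw [norm_mul, norm_exp_ofReal_mul_I, mul_one] at h2
      linarith
    -- Solving v sin(η - w) = sin w for e^{2iw} gives W.
    set W : ℂ := (1 + v * exp (η * I)) / (1 + v * exp ((-η : ℝ) * I)) with hW
    have hW0 : W ≠ 0 := div_ne_zero (hA _) (hA _)
    set w : ℂ := log W / (2 * I) with hw
    have hexp : exp (2 * I * w) = W := by
      rw [hw, mul_div_cancel₀ _ (by simp), exp_log hW0]
    have hre : w.re = arg W / 2 := by
      rw [hw, ← log_im]
      simp [div_re, normSq_apply]
      ring
    have hrel : v * sin (η - w) = sin w := by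
      have h1 : exp (2 * I * w) * (1 + v * exp ((-η : ℝ) * I)) = 1 + v * exp (η * I) := by
        rw [hexp, hW, div_mul_cancel₀ _ (hA _)]
      have h2 : exp (2 * I * w) = exp (w * I) * exp (w * I) := by rw [← exp_add]; ring_nf
      have h3 : exp (w * I) * exp (-w * I) = 1 := by rw [← exp_add]; ring_nf; simp
      rw [h2] at h1
      rw [Complex.sin, Complex.sin]
      have e1 : exp (-(η - w) * I) = exp ((-η : ℝ) * I) * exp (w * I) := by
        rw [← exp_add]; push_cast; ring_nf
      have e2 : exp ((η - w) * I) = exp (η * I) * exp (-w * I) := by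
        rw [← exp_add]; ring_nf
      rw [e1, e2]
      linear_combination (I / 2 * exp (-w * I)) * h1 -
        (exp (w * I) * (1 + v * exp ((-η : ℝ) * I)) * I / 2) * h3
    have hS : sin (η - w) ≠ 0 := by
      intro h
      have h2 : sin w = 0 := by rw [← hrel, h, mul_zero]
      have := sin_sq_add_law (η := η) w
      rw [h, h2] at this
      simp only [ne_eq, OfNat.ofNat_ne_zero, not_false_eq_true, zero_pow, mul_zero, add_zero] at this
      exact hsc (pow_eq_zero_iff two_ne_zero |>.1 this.symm)
    have hlt : ‖sin w‖ < ‖sin (η - w)‖ := by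
      rw [← hrel, norm_mul]
      exact mul_lt_of_lt_one_left (norm_pos_iff.2 hS) hv
    rw [norm_sin_lt_iff hs, hre] at hlt
    have hb := arg_mem_Ioc W
    refine ⟨w, ?_, by rw [← hrel, mul_div_cancel_right₀ _ hS]⟩
    rw [hre]
    -- Here η - arg W lies in [η - π, η + π); positivity of its sine leaves only (0, π), so the
    -- principal branch lands in the required strip.
    constructor
    · by_contra hc
      have h3 := Real.sin_nonpos_of_nonpos_of_neg_pi_le
        (x := (η - 2 * (arg W / 2)) - 2 * Real.pi) (by linarith [hb.1]) (by linarith)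
      rw [Real.sin_sub_two_pi] at h3
      linarith
    · by_contra hc
      have h3 := Real.sin_nonpos_of_nonpos_of_neg_pi_le
        (x := (η - 2 * (arg W / 2))) (by linarith) (by linarith [hb.2])
      linarith
  · intro x hx
    refine ⟨Real.sin (η - 2 * x) / (2 * Real.sin η ^ 2), fun y => Real.sinh (2 * y),
      div_pos (hJ x hx) (by positivity), tendsto_sinh_two_mul_atTop, tendsto_sinh_two_mul_atBot,
      fun y => ?_⟩
    have hw : (x + y * I : ℂ).re ∈ Ioo ((η - Real.pi) / 2) (η / 2) := by simpa using hx
    rw [hq _ hw]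
    have h1 := hne _ hw
    -- κ/Q(κ) = sin w sin(η - w)/sin² η, and the product of sines becomes a difference of cosines.
    have h2 : sin (x + y * I) / sin (η - (x + y * I)) / (sin η ^ 2 / sin (η - (x + y * I)) ^ 2)
        = (((1 / (2 * Real.sin η ^ 2) : ℝ)) : ℂ) *
          (cos (((2 * x - η : ℝ) : ℂ) + ((2 * y : ℝ) : ℂ) * I) - (Real.cos η : ℂ)) := by
      have e1 : ((2 * x - η : ℝ) : ℂ) + ((2 * y : ℝ) : ℂ) * I
          = (x + y * I) - (η - (x + y * I)) := by push_cast; ring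
      have e2 : (Real.cos η : ℂ) = cos ((x + y * I) + (η - (x + y * I))) := by
        push_cast; ring_nf
      rw [e1, e2, Complex.cos_sub (x + y * I), Complex.cos_add (x + y * I)]
      push_cast
      field_simp
      ring
    rw [h2, im_ofReal_mul, sub_im, ofReal_im, cos_add_mul_I]
    rw [← ofReal_cos, ← ofReal_cosh, ← ofReal_sin, ← ofReal_sinh, ← ofReal_mul, ← ofReal_mul]
    simp only [sub_im, ofReal_im, im_ofReal_mul, I_im]
    have : Real.sin (2 * x - η) = -Real.sin (η - 2 * x) := by rw [← Real.sin_neg]; ring_nf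
    rw [this]
    ring

theorem exists_isStripParam (η : ℝ) : ∃ J κ m, IsStripParam (Real.cos η) J κ m := by
  rcases eq_or_lt_of_le (Real.neg_one_le_cos η) with h | h
  · rw [← h]; exact ⟨_, _, _, isStripParam_neg_one⟩
  rcases eq_or_lt_of_le (Real.cos_le_one η) with h' | h'
  · rw [h']; exact ⟨_, _, _, isStripParam_one⟩
  rw [← Real.cos_arccos h.le h'.le]
  exact ⟨_, _, _, isStripParam_cos (Real.arccos_pos.2 h')
    (lt_of_le_of_ne (Real.arccos_le_pi _) fun e => h.not_ge (Real.arccos_eq_pi.1 e))⟩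

/-! ### Positivity estimates in the disc. -/

lemma mem_unitDisc {z : ℂ} : z ∈ unitDisc ↔ ‖z‖ < 1 := mem_ball_zero_iff

lemma isOpen_unitDisc : IsOpen unitDisc := Metric.isOpen_ball

/-- The real part factors as (1 - |v|²)(1 + |v|² + 2C Re v), and the second factor is at least (1 -
|Re v|)². -/
lemma re_mul_conj_pos {C : ℝ} (h1 : -1 ≤ C) (h2 : C ≤ 1) {v : ℂ} (hv : ‖v‖ < 1) :
    0 < ((1 - v ^ 2) * conj (1 + 2 * C * v + v ^ 2)).re := by
  have hn : v.re * v.re + v.im * v.im < 1 := by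
    rw [← normSq_apply, normSq_eq_norm_sq]
    exact pow_lt_one₀ (norm_nonneg _) hv two_ne_zero
  have e : ((1 - v ^ 2) * conj (1 + 2 * C * v + v ^ 2)).re
      = (1 - (v.re * v.re + v.im * v.im)) * (1 + (v.re * v.re + v.im * v.im) + 2 * C * v.re) := by
    simp [pow_two]
    ring
  rw [e]
  refine mul_pos (by linarith) ?_
  have hx : |v.re| < 1 := (abs_re_le_norm v).trans_lt hv
  have hC : |C| ≤ 1 := abs_le.2 ⟨h1, h2⟩
  have h3 : -|v.re| ≤ C * v.re := by
    have : |C * v.re| ≤ |v.re| := by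
      rw [abs_mul]; exact mul_le_of_le_one_left (abs_nonneg _) hC
    linarith [neg_abs_le (C * v.re)]
  have h4 : |v.re| * |v.re| = v.re * v.re := abs_mul_abs_self _
  nlinarith [mul_self_nonneg v.im, mul_pos (sub_pos.2 hx) (sub_pos.2 hx)]

lemma one_add_two_mul_add_sq_ne_zero {C : ℝ} (h1 : -1 ≤ C) (h2 : C ≤ 1) {v : ℂ} (hv : ‖v‖ < 1) :
    1 + 2 * C * v + v ^ 2 ≠ 0 := by
  intro h
  have := re_mul_conj_pos h1 h2 hv
  rw [h] at this
  simp at this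

lemma re_one_sub_sq_div_pos {C : ℝ} (h1 : -1 ≤ C) (h2 : C ≤ 1) {v : ℂ} (hv : ‖v‖ < 1) :
    0 < ((1 - v ^ 2) / (1 + 2 * C * v + v ^ 2)).re := by
  have hne := one_add_two_mul_add_sq_ne_zero h1 h2 hv
  have h := re_mul_conj_pos h1 h2 hv
  rw [div_eq_mul_inv, Complex.inv_def, ← mul_assoc, re_mul_ofReal]
  exact mul_pos h (inv_pos.2 (normSq_pos.2 hne))

lemma norm_mul_pow_lt_one {n : ℕ} (hn : 1 ≤ n) {c v : ℂ} (hc : ‖c‖ = 1) (hv : ‖v‖ < 1) :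
    ‖c * v ^ n‖ < 1 := by
  rw [norm_mul, hc, one_mul, norm_pow]
  exact pow_lt_one₀ (norm_nonneg _) hv (by omega)

lemma one_sub_ne_zero_of_norm_lt {z : ℂ} (hz : ‖z‖ < 1) : 1 - z ≠ 0 := by
  intro h
  rw [← sub_eq_zero.1 h] at hz
  simp at hz

/-- βP lies in the right half-plane, so it is no farther from κ ≥ 0 than from -κ; the factor ζ makes
the inequality strict. -/
lemma norm_neg_add_lt_norm_add {κ β : ℝ} (hκ : 0 ≤ κ) (hβ : 0 < β) {P ζ : ℂ} (hP : 0 < P.re)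
    (hζ : ‖ζ‖ < 1) : ‖ζ * (-κ + β * P)‖ < ‖κ + β * P‖ := by
  have h0 : 0 < ‖κ + β * P‖ := by
    refine norm_pos_iff.2 fun h => ?_
    have := congrArg re h
    simp at this
    nlinarith [mul_pos hβ hP]
  have h1 : ‖-κ + β * P‖ ≤ ‖κ + β * P‖ := by
    rw [← sq_le_sq₀ (norm_nonneg _) (norm_nonneg _), ← normSq_eq_norm_sq, ← normSq_eq_norm_sq,
      normSq_apply, normSq_apply]
    simp
    nlinarith [mul_nonneg hκ (mul_pos hβ hP).le]
  rw [norm_mul]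
  calc ‖ζ‖ * ‖-κ + β * P‖ ≤ ‖ζ‖ * ‖κ + β * P‖ := by gcongr
    _ < 1 * ‖κ + β * P‖ := by gcongr
    _ = _ := one_mul _

/-! ### Univalence and convexity of the rotated convolution. -/

/-- Data of a harmonic shear `R + conj S` of a map with derivative `1 / (1 + 2 v cos η + v²)` and
dilatation `c vⁿ`. -/
structure IsStripShear (η : ℝ) (n : ℕ) (c : ℂ) (R S : ℂ → ℂ) : Prop where
  one_le : 1 ≤ n
  norm_eq : ‖c‖ = 1
  diff_R : DifferentiableOn ℂ R unitDisc
  diff_S : DifferentiableOn ℂ S unitDisc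
  deriv_sub : ∀ v ∈ unitDisc,
    deriv R v - deriv S v = 1 / (1 + 2 * (Real.cos η : ℝ) * v + v ^ 2)
  dilatation : ∀ v ∈ unitDisc, deriv S v = c * v ^ n * deriv R v

/-- The analytic part of the convolution, up to rotation. -/
noncomputable def convH (β : ℝ) (R : ℂ → ℂ) : ℂ → ℂ := fun v => β * (v * deriv R v) + (1 - β) * R v

/-- The co-analytic part of the convolution, up to rotation. -/
noncomputable def convG (β : ℝ) (S : ℂ → ℂ) : ℂ → ℂ := fun v => β * (v * deriv S v) - (1 - β) * S v

namespace IsStripShear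

variable {η β : ℝ} {n : ℕ} {c : ℂ} {R S : ℂ → ℂ}

lemma deriv_R_eq (h : IsStripShear η n c R S) {v : ℂ} (hv : v ∈ unitDisc) :
    deriv R v = 1 / ((1 + 2 * (Real.cos η : ℝ) * v + v ^ 2) * (1 - c * v ^ n)) := by
  have h1 := h.deriv_sub v hv
  have h2 := one_sub_ne_zero_of_norm_lt
    (norm_mul_pow_lt_one h.one_le h.norm_eq (mem_unitDisc.1 hv))
  rw [h.dilatation v hv] at h1
  rw [← div_div, ← h1, eq_div_iff h2]
  ring

/-- Here q is the logarithmic derivative vR''/R' = -vQ'/Q + nζ/(1 - ζ), rewritten through two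
functions of positive real part. The extra n for S comes from the factor vⁿ. -/
lemma exists_hasDerivAt (h : IsStripShear η n c R S) {v : ℂ} (hv : v ∈ unitDisc) :
    ∃ q : ℂ, q = -1 - n / 2 + ((1 - v ^ 2) / (1 + 2 * (Real.cos η : ℝ) * v + v ^ 2)
        + n / 2 * ((1 + c * v ^ n) / (1 - c * v ^ n))) ∧
      ∃ R2 S2 : ℂ, HasDerivAt (deriv R) R2 v ∧ v * R2 = q * deriv R v ∧
      HasDerivAt (deriv S) S2 v ∧ v * S2 = (n + q) * (c * v ^ n * deriv R v) := by
  obtain ⟨k, rfl⟩ : ∃ k, n = k + 1 := ⟨n - 1, by have := h.one_le; omega⟩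
  have hv' := mem_unitDisc.1 hv
  have hQ := one_add_two_mul_add_sq_ne_zero (Real.neg_one_le_cos η) (Real.cos_le_one η) hv'
  have hζ := one_sub_ne_zero_of_norm_lt (norm_mul_pow_lt_one h.one_le h.norm_eq hv')
  have hnear : ∀ᶠ z in 𝓝 v, z ∈ unitDisc := isOpen_unitDisc.mem_nhds hv
  have dQ : HasDerivAt (fun z : ℂ => 1 + 2 * ((Real.cos η : ℝ) : ℂ) * z + z ^ 2)
      (2 * (Real.cos η : ℝ) + 2 * v) v := by
    have := (((hasDerivAt_id v).const_mul (2 * ((Real.cos η : ℝ) : ℂ))).const_add 1).add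
      ((hasDerivAt_id v).pow 2)
    refine this.congr_deriv ?_
    simp
  have dZ : HasDerivAt (fun z : ℂ => c * z ^ (k + 1)) (c * ((k + 1) * v ^ k)) v := by
    have := (hasDerivAt_pow (k + 1) v).const_mul c
    refine this.congr_deriv ?_
    simp
  have dR := ((dQ.mul (dZ.const_sub 1)).inv (mul_ne_zero hQ hζ)).congr_of_eventuallyEq
    (f₁ := deriv R) (by
      filter_upwards [hnear] with z hz
      rw [h.deriv_R_eq hz, one_div]
      rfl)
  have dS := (dZ.mul dR).congr_of_eventuallyEq (f₁ := deriv S) (by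
      filter_upwards [hnear] with z hz
      rw [h.dilatation z hz]
      rfl)
  refine ⟨_, rfl, _, _, dR, ?_, dS, ?_⟩
  · rw [h.deriv_R_eq hv]
    simp only [Pi.mul_apply]
    generalize ((Real.cos η : ℝ) : ℂ) = C at hQ ⊢
    generalize hQe : 1 + 2 * C * v + v ^ 2 = Q at hQ ⊢
    push_cast
    field_simp
    rw [← hQe]
    ring
  · rw [h.deriv_R_eq hv]
    simp only [Pi.mul_apply]
    generalize ((Real.cos η : ℝ) : ℂ) = C at hQ ⊢
    generalize hQe : 1 + 2 * C * v + v ^ 2 = Q at hQ ⊢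
    push_cast
    field_simp
    rw [← hQe]
    ring

lemma exists_hasDerivAt_conv (h : IsStripShear η n c R S) (β : ℝ) {v : ℂ} (hv : v ∈ unitDisc) :
    ∃ P : ℂ, P = (1 - v ^ 2) / (1 + 2 * (Real.cos η : ℝ) * v + v ^ 2)
        + n / 2 * ((1 + c * v ^ n) / (1 - c * v ^ n)) ∧
      HasDerivAt (convH β R)
        (deriv R v * (((1 - β * (1 + n / 2) : ℝ) : ℂ) + β * P)) v ∧
      HasDerivAt (convG β S)
        (deriv R v * ((c * v ^ n) * (-((1 - β * (1 + n / 2) : ℝ) : ℂ) + β * P))) v := by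
  obtain ⟨q, hq, R2, S2, dR, hR2, dS, hS2⟩ := h.exists_hasDerivAt hv
  have hnear := isOpen_unitDisc.mem_nhds hv
  have eR := (h.diff_R.differentiableAt hnear).hasDerivAt
  have eS := (h.diff_S.differentiableAt hnear).hasDerivAt
  refine ⟨_, rfl, ?_, ?_⟩
  · have := (((hasDerivAt_id v).mul dR).const_mul (β : ℂ)).add (eR.const_mul (1 - β : ℂ))
    refine this.congr_deriv ?_
    simp only [id]
    rw [hR2, ← sub_eq_iff_eq_add'.2 hq]
    push_cast
    ring
  · have := (((hasDerivAt_id v).mul dS).const_mul (β : ℂ)).sub (eS.const_mul (1 - β : ℂ))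
    refine this.congr_deriv ?_
    simp only [id]
    rw [hS2, h.dilatation v hv, ← sub_eq_iff_eq_add'.2 hq]
    push_cast
    ring

lemma differentiableOn_convH (h : IsStripShear η n c R S) (β : ℝ) :
    DifferentiableOn ℂ (convH β R) unitDisc := fun _ hv => by
  obtain ⟨P, -, hH, -⟩ := h.exists_hasDerivAt_conv β hv
  exact hH.differentiableAt.differentiableWithinAt

lemma differentiableOn_convG (h : IsStripShear η n c R S) (β : ℝ) :
    DifferentiableOn ℂ (convG β S) unitDisc := fun _ hv => by
  obtain ⟨P, -, -, hG⟩ := h.exists_hasDerivAt_conv β hv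
  exact hG.differentiableAt.differentiableWithinAt

lemma re_one_add_div_one_sub_pos (h : IsStripShear η n c R S) {v : ℂ} (hv : v ∈ unitDisc) :
    0 < ((1 + c * v ^ n) / (1 - c * v ^ n)).re :=
  re_add_div_sub_pos (by
    simpa using norm_mul_pow_lt_one h.one_le h.norm_eq (mem_unitDisc.1 hv))

lemma deriv_R_ne_zero (h : IsStripShear η n c R S) {v : ℂ} (hv : v ∈ unitDisc) :
    deriv R v ≠ 0 := by
  have hv' := mem_unitDisc.1 hv
  rw [h.deriv_R_eq hv]
  exact one_div_ne_zero (mul_ne_zero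
    (one_add_two_mul_add_sq_ne_zero (Real.neg_one_le_cos η) (Real.cos_le_one η) hv')
    (one_sub_ne_zero_of_norm_lt (norm_mul_pow_lt_one h.one_le h.norm_eq hv')))

lemma norm_deriv_convG_lt (h : IsStripShear η n c R S) (hβ0 : 0 < β) (hβ : β * (n + 2) ≤ 2)
    {v : ℂ} (hv : v ∈ unitDisc) : ‖deriv (convG β S) v‖ < ‖deriv (convH β R) v‖ := by
  have hv' := mem_unitDisc.1 hv
  obtain ⟨P, hP, hH, hG⟩ := h.exists_hasDerivAt_conv β hv
  rw [hH.deriv, hG.deriv, norm_mul, norm_mul (deriv R v)]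
  refine mul_lt_mul_of_pos_left ?_ (norm_pos_iff.2 (h.deriv_R_ne_zero hv))
  refine norm_neg_add_lt_norm_add (by linarith) hβ0 ?_
    (norm_mul_pow_lt_one h.one_le h.norm_eq hv')
  have h1 := re_one_sub_sq_div_pos (Real.neg_one_le_cos η) (Real.cos_le_one η) hv'
  have h2 := h.re_one_add_div_one_sub_pos hv
  have h3 : (n / 2 : ℂ) = ((n / 2 : ℝ) : ℂ) := by push_cast; ring
  rw [hP, add_re, h3, re_ofReal_mul]
  positivity

lemma deriv_conv_sub_mul (h : IsStripShear η n c R S) (β : ℝ) {v : ℂ} (hv : v ∈ unitDisc) :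
    (deriv (convH β R) v - deriv (convG β S) v) * (1 + 2 * (Real.cos η : ℝ) * v + v ^ 2)
      = β * ((1 - v ^ 2) / (1 + 2 * (Real.cos η : ℝ) * v + v ^ 2))
        + ((1 - β : ℝ) : ℂ) * ((1 + c * v ^ n) / (1 - c * v ^ n)) := by
  have hv' := mem_unitDisc.1 hv
  have hQ := one_add_two_mul_add_sq_ne_zero (Real.neg_one_le_cos η) (Real.cos_le_one η) hv'
  have hζ := one_sub_ne_zero_of_norm_lt (norm_mul_pow_lt_one h.one_le h.norm_eq hv')
  obtain ⟨P, hP, hH, hG⟩ := h.exists_hasDerivAt_conv β hv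
  rw [hH.deriv, hG.deriv, h.deriv_R_eq hv, hP]
  push_cast
  push_cast at hQ
  field_simp
  ring

lemma conv_sub_eq (h : IsStripShear η n c R S) (β : ℝ) {v : ℂ} (hv : v ∈ unitDisc) :
    convH β R v - convG β S v
      = β * (v / (1 + 2 * (Real.cos η : ℝ) * v + v ^ 2)) + ((1 - β : ℝ) : ℂ) * (R v + S v) := by
  have := h.deriv_sub v hv
  rw [convH, convG, div_eq_mul_one_div v, ← this]
  push_cast
  ring

theorem injOn_and_isPreconnected (h : IsStripShear η n c R S) (hβ0 : 0 < β) (hβ1 : β < 1)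
    (hβ : β * (n + 2) ≤ 2) :
    InjOn (harmonicSum (convH β R) (convG β S)) unitDisc ∧
      ∀ d : ℝ, IsPreconnected
        (harmonicSum (convH β R) (convG β S) '' unitDisc ∩ {w | w.im = d}) := by
  obtain ⟨J, κ, m, hκ⟩ := exists_isStripParam η
  have hD : ∀ w : ℂ, w.re ∈ J → κ w ∈ unitDisc := fun w hw => mem_unitDisc.2 (hκ.norm_lt w hw)
  have hQ : ∀ w : ℂ, w.re ∈ J → 1 + 2 * ((Real.cos η : ℝ) : ℂ) * κ w + κ w ^ 2 ≠ 0 := fun w hw =>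
    one_add_two_mul_add_sq_ne_zero (Real.neg_one_le_cos η) (Real.cos_le_one η) (hκ.norm_lt w hw)
  have hm : (m : ℂ) ≠ 0 := ofReal_ne_zero.2 hκ.pos.ne'
  have dH : ∀ w : ℂ, w.re ∈ J → HasDerivAt (convH β R ∘ κ)
      (deriv (convH β R) (κ w) * (m * (1 + 2 * (Real.cos η : ℝ) * κ w + κ w ^ 2))) w :=
    fun w hw => (((h.differentiableOn_convH β).differentiableAt
      (isOpen_unitDisc.mem_nhds (hD w hw))).hasDerivAt).comp w (hκ.hasDerivAt w hw)
  have dG : ∀ w : ℂ, w.re ∈ J → HasDerivAt (convG β S ∘ κ)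
      (deriv (convG β S) (κ w) * (m * (1 + 2 * (Real.cos η : ℝ) * κ w + κ w ^ 2))) w :=
    fun w hw => (((h.differentiableOn_convG β).differentiableAt
      (isOpen_unitDisc.mem_nhds (hD w hw))).hasDerivAt).comp w (hκ.hasDerivAt w hw)
  have dT : ∀ w : ℂ, w.re ∈ J → HasDerivAt (fun w => R (κ w) + S (κ w))
      (m * ((1 + c * κ w ^ n) / (1 - c * κ w ^ n))) w := by
    intro w hw
    have hn := isOpen_unitDisc.mem_nhds (hD w hw)
    have := ((h.diff_R.differentiableAt hn).hasDerivAt.comp w (hκ.hasDerivAt w hw)).add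
      ((h.diff_S.differentiableAt hn).hasDerivAt.comp w (hκ.hasDerivAt w hw))
    refine this.congr_deriv ?_
    have h1 := hQ w hw
    have h2 := one_sub_ne_zero_of_norm_lt
      (norm_mul_pow_lt_one h.one_le h.norm_eq (hκ.norm_lt w hw))
    rw [h.dilatation _ (hD w hw), h.deriv_R_eq (hD w hw)]
    field_simp
  have hmem : ∀ x ∈ J, ∀ y : ℝ, (x + y * I : ℂ).re ∈ J := by
    intro x hx y; simpa using hx
  have hmonoT : ∀ x ∈ J, Monotone (fun y : ℝ => (R (κ (x + y * I)) + S (κ (x + y * I))).im) :=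
    fun x hx => monotone_im_vertical (f := fun w => R (κ w) + S (κ w))
      (f' := fun w => m * ((1 + c * κ w ^ n) / (1 - c * κ w ^ n)))
      (fun y => dT _ (hmem x hx y)) (fun y => by
        rw [re_ofReal_mul]
        exact (mul_pos hκ.pos (h.re_one_add_div_one_sub_pos (hD _ (hmem x hx y)))).le)
  have him : ∀ x ∈ J, ∃ (A : ℝ) (a : ℝ → ℝ), 0 < A ∧ Tendsto a atTop atTop ∧
      Tendsto a atBot atBot ∧ ∀ y : ℝ,
      ((convH β R ∘ κ) (x + y * I) - (convG β S ∘ κ) (x + y * I)).im =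
        A * a y + (1 - β) * (R (κ (x + y * I)) + S (κ (x + y * I))).im := by
    intro x hx
    obtain ⟨A, a, hA, h1, h2, h3⟩ := hκ.im_tendsto x hx
    refine ⟨β * A, a, mul_pos hβ0 hA, h1, h2, fun y => ?_⟩
    simp only [Function.comp]
    rw [h.conv_sub_eq β (hD _ (hmem x hx y)), add_im, im_ofReal_mul, im_ofReal_mul, h3 y]
    ring
  have hβ1' : 0 ≤ 1 - β := by linarith
  obtain ⟨hinj, hpre⟩ := shear_strip hκ.isOpen hκ.ordConnected dH dG
    (fun w hw => by
      have := h.deriv_conv_sub_mul β (hD w hw)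
      have e : deriv (convH β R) (κ w) * (m * (1 + 2 * (Real.cos η : ℝ) * κ w + κ w ^ 2)) -
          deriv (convG β S) (κ w) * (m * (1 + 2 * (Real.cos η : ℝ) * κ w + κ w ^ 2))
          = m * ((deriv (convH β R) (κ w) - deriv (convG β S) (κ w)) *
              (1 + 2 * (Real.cos η : ℝ) * κ w + κ w ^ 2)) := by ring
      rw [e, this, re_ofReal_mul, add_re, re_ofReal_mul, re_ofReal_mul]
      have h1 := re_one_sub_sq_div_pos (Real.neg_one_le_cos η) (Real.cos_le_one η)
        (hκ.norm_lt w hw)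
      have h2 := h.re_one_add_div_one_sub_pos (hD w hw)
      have h3 := hκ.pos
      positivity)
    (fun w hw => by
      rw [norm_mul, norm_mul (deriv (convH β R) (κ w))]
      exact mul_lt_mul_of_pos_right (h.norm_deriv_convG_lt hβ0 hβ (hD w hw))
        (norm_pos_iff.2 (mul_ne_zero hm (hQ w hw))))
    (fun x hx => by
      obtain ⟨A, a, hA, h1, h2, h3⟩ := him x hx
      simp only [h3]
      -- For y ≥ 0 the monotone term Im(R + S) is at least its value at y = 0, so the unbounded term
      -- decides the limit.
      refine tendsto_atTop_mono' _ ?_ (tendsto_atTop_add_const_right _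
        ((1 - β) * (R (κ (x + (0 : ℝ) * I)) + S (κ (x + (0 : ℝ) * I))).im)
        (h1.const_mul_atTop hA))
      filter_upwards [eventually_ge_atTop 0] with y hy
      have := mul_le_mul_of_nonneg_left (hmonoT x hx hy) hβ1'
      simp only at this
      linarith)
    (fun x hx => by
      obtain ⟨A, a, hA, h1, h2, h3⟩ := him x hx
      simp only [h3]
      refine tendsto_atBot_mono' _ ?_ (tendsto_atBot_add_const_right _
        ((1 - β) * (R (κ (x + (0 : ℝ) * I)) + S (κ (x + (0 : ℝ) * I))).im)
        (h2.const_mul_atBot hA))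
      filter_upwards [eventually_le_atBot 0] with y hy
      have := mul_le_mul_of_nonneg_left (hmonoT x hx hy) hβ1'
      simp only at this
      linarith)
  have himg : harmonicSum (convH β R ∘ κ) (convG β S ∘ κ) '' (re ⁻¹' J)
      = harmonicSum (convH β R) (convG β S) '' unitDisc := by
    ext z
    constructor
    · rintro ⟨w, hw, rfl⟩
      exact ⟨κ w, hD w hw, rfl⟩
    · rintro ⟨v, hv, rfl⟩
      obtain ⟨w, hw, rfl⟩ := hκ.surj v (mem_unitDisc.1 hv)
      exact ⟨w, hw, rfl⟩
  refine ⟨fun a ha b hb hab => ?_, fun d => himg ▸ hpre d⟩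
  obtain ⟨w, hw, rfl⟩ := hκ.surj a (mem_unitDisc.1 ha)
  obtain ⟨w', hw', rfl⟩ := hκ.surj b (mem_unitDisc.1 hb)
  rw [hinj hw hw' hab]

theorem convexInDirection (h : IsStripShear η n c R S) (hβ0 : 0 < β) (hβ1 : β < 1)
    (hβ : β * (n + 2) ≤ 2) :
    ConvexInDirection (harmonicSum (convH β R) (convG β S)) 0 := by
  intro p
  have : {w : ℂ | ∃ t : ℝ, w = p + (t : ℂ) * exp ((0 : ℝ) * I)} = {w | w.im = p.im} := by
    ext w
    simp only [mem_ofPred_eq, ofReal_zero, zero_mul, exp_zero, mul_one]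
    constructor
    · rintro ⟨t, rfl⟩
      simp
    · intro hw
      exact ⟨w.re - p.re, by apply Complex.ext <;> simp [hw]⟩
  rw [this]
  exact (h.injOn_and_isPreconnected hβ0 hβ1 hβ).2 _

end IsStripShear

/-! ### Taylor coefficients and convolution with f_{b,α}. -/

lemma taylorCoeff_of_hasSum {f : ℂ → ℂ} {a : ℕ → ℂ}
    (h : ∀ z ∈ unitDisc, HasSum (fun m => a m * z ^ m) (f z)) (m : ℕ) :
    taylorCoeff f m = a m := by
  have h1 : HasFPowerSeriesAt f (FormalMultilinearSeries.ofScalars ℂ a) 0 := by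
    rw [hasFPowerSeriesAt_iff]
    filter_upwards [isOpen_unitDisc.mem_nhds (show (0 : ℂ) ∈ unitDisc by simp)] with z hz
    simpa [FormalMultilinearSeries.coeff_ofScalars, mul_comm] using h z hz
  have h2 := h1.analyticAt.hasFPowerSeriesAt.eq_formalMultilinearSeries h1
  have h3 := congrArg (fun p => FormalMultilinearSeries.coeff p m) h2
  simpa [FormalMultilinearSeries.coeff_ofScalars, taylorCoeff] using h3

lemma hasSum_taylorCoeff {f : ℂ → ℂ} (hf : DifferentiableOn ℂ f unitDisc) {z : ℂ}
    (hz : z ∈ unitDisc) : HasSum (fun m => taylorCoeff f m * z ^ m) (f z) := by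
  refine (Complex.hasSum_taylorSeries_on_ball hf hz).congr_fun fun m => ?_
  simp only [taylorCoeff, smul_eq_mul, sub_zero]
  ring

lemma taylorCoeff_zero (f : ℂ → ℂ) : taylorCoeff f 0 = f 0 := by simp [taylorCoeff]

lemma hasSum_mul_taylorCoeff {f : ℂ → ℂ} (hf : DifferentiableOn ℂ f unitDisc) {z : ℂ}
    (hz : z ∈ unitDisc) : HasSum (fun m : ℕ => m * taylorCoeff f m * z ^ m) (z * deriv f z) := by
  have h1 := (hasSum_taylorCoeff (hf.deriv isOpen_unitDisc) hz).mul_left z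
  rw [← hasSum_nat_add_iff' 1]
  simp only [Finset.range_one, Finset.sum_singleton, Nat.cast_zero, zero_mul, sub_zero]
  refine h1.congr_fun fun m => ?_
  have hm : (m.factorial : ℂ) ≠ 0 := Nat.cast_ne_zero.2 m.factorial_ne_zero
  have hm' : (m : ℂ) + 1 ≠ 0 := Nat.cast_add_one_ne_zero m
  simp only [taylorCoeff, iteratedDeriv_succ', Nat.factorial_succ]
  push_cast
  field_simp
  ring

/-- Convolution with a function whose Taylor coefficients are `A aᵐ (β m + δ)`. -/
lemma hadamardProd_eq {f r : ℂ → ℂ} (hr : DifferentiableOn ℂ r unitDisc) (hr0 : r 0 = 0)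
    {a A β δ : ℂ} (ha : ‖a‖ = 1) (hf : ∀ m ≠ 0, taylorCoeff f m = A * a ^ m * (β * m + δ))
    {z : ℂ} (hz : z ∈ unitDisc) :
    hadamardProd f r z = A * (β * (z * a * deriv r (z * a)) + δ * r (z * a)) := by
  have hza : z * a ∈ unitDisc := by
    rw [mem_unitDisc, norm_mul, ha, mul_one]; exact mem_unitDisc.1 hz
  have h := (((hasSum_mul_taylorCoeff hr hza).mul_left β).add
    ((hasSum_taylorCoeff hr hza).mul_left δ)).mul_left A
  refine (h.congr_fun fun m => ?_).tsum_eq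
  -- The formula for f is not assumed at m = 0; that term vanishes because r 0 = 0.
  rcases eq_or_ne m 0 with rfl | hm
  · simp [taylorCoeff_zero, hr0]
  · rw [hf m hm, mul_pow]
    ring

lemma hasSum_half_plane {a z : ℂ} (h : ‖z * a‖ < 1) :
    HasSum (fun m : ℕ => (a ^ m - if m = 0 then 1 else 0) * z ^ m) (a * (z / (1 - z * a))) := by
  have hne := one_sub_ne_zero_of_norm_lt h
  have h1 := (hasSum_geometric_of_norm_lt_one h).sub (hasSum_ite_eq (0 : ℕ) (1 : ℂ))
  have e : a * (z / (1 - z * a)) = (1 - z * a)⁻¹ - 1 := by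
    generalize hE : 1 - z * a = E at hne
    field_simp
    rw [← hE]
    ring
  rw [e]
  refine h1.congr_fun fun m => ?_
  rcases eq_or_ne m 0 with rfl | hm
  · simp
  · simp only [if_neg hm, mul_pow]; ring

lemma hasSum_koebe {a z : ℂ} (h : ‖z * a‖ < 1) :
    HasSum (fun m : ℕ => (m * a ^ m) * z ^ m) (a * (z / (1 - z * a) ^ 2)) := by
  have h1 := hasSum_coe_mul_geometric_of_norm_lt_one h
  have e : a * (z / (1 - z * a) ^ 2) = z * a / (1 - z * a) ^ 2 := by ring
  rw [e]
  refine h1.congr_fun fun m => ?_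
  rw [mul_pow]; ring

lemma exp_two_mul_mul_I (t : ℝ) : exp (2 * t * I) = exp (t * I) ^ 2 := by
  rw [← exp_nat_mul]; push_cast; ring_nf

lemma exp_neg_two_mul_mul_I (t : ℝ) : exp (-2 * t * I) = (exp (t * I) ^ 2)⁻¹ := by
  rw [← exp_nat_mul, ← exp_neg]; push_cast; ring_nf

lemma IsShear.deriv_eq {h g k w : ℂ → ℂ} {t : ℝ} (H : IsShear h g t k w) {z : ℂ}
    (hz : z ∈ unitDisc) : deriv h z - (exp (t * I) ^ 2)⁻¹ * deriv g z = deriv k z := by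
  have hn := isOpen_unitDisc.mem_nhds hz
  have h1 := (H.analytic_h.differentiableAt hn).hasDerivAt.sub
    ((H.analytic_g.differentiableAt hn).hasDerivAt.const_mul (exp (t * I) ^ 2)⁻¹)
  refine (h1.congr_of_eventuallyEq ?_).deriv.symm
  filter_upwards [hn] with y hy
  rw [← H.diff_eq y hy, exp_neg_two_mul_mul_I]
  rfl

lemma norm_mul_exp_lt {z : ℂ} (hz : z ∈ unitDisc) (t : ℝ) : ‖z * exp (t * I)‖ < 1 := by
  rw [norm_mul, norm_exp_ofReal_mul_I, mul_one]; exact mem_unitDisc.1 hz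

/-- The dilatation and the difference h - a⁻²g determine h' and g'; integrating h' + a⁻²g' gives a
Koebe-type function. Sum and difference together recover h and g. -/
lemma IsFMap.add_eq {b α : ℝ} {h g : ℂ → ℂ} (hb : -1 < b) (hb1 : b < 1) (H : IsFMap b α h g) :
    EqOn (fun z => h z + (exp (α * I) ^ 2)⁻¹ * g z)
      (fun z => (1 + b) / (1 - b) * (z / (1 - z * exp (α * I)) ^ 2)) unitDisc := by
  set a := exp (α * I) with ha
  have ha0 : a ≠ 0 := exp_ne_zero _
  have hb' : (1 - b : ℂ) ≠ 0 := by
    have : (1 - b : ℝ) ≠ 0 := by linarith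
    exact_mod_cast this
  have hne : ∀ z ∈ unitDisc, 1 - z * a ≠ 0 := fun z hz =>
    one_sub_ne_zero_of_norm_lt (norm_mul_exp_lt hz α)
  have hne2 : ∀ z ∈ unitDisc, 1 + b * z * a ≠ 0 := by
    intro z hz h0
    have h1 : ‖b * z * a‖ = 1 := by rw [eq_neg_of_add_eq_zero_right h0]; simp
    have h2 : ‖(b : ℂ)‖ ≤ 1 := by
      rw [norm_real, Real.norm_eq_abs]; exact abs_le.2 ⟨hb.le, hb1.le⟩
    rw [mul_assoc, norm_mul] at h1
    nlinarith [norm_mul_exp_lt hz α, norm_nonneg (z * a)]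
  have dlin : ∀ z : ℂ, HasDerivAt (fun z : ℂ => 1 - z * a) (-a) z := fun z => by
    simpa using ((hasDerivAt_id z).mul_const a).const_sub 1
  have dk : ∀ z ∈ unitDisc, HasDerivAt (fun z : ℂ => z / (1 - z * a)) (1 / (1 - z * a) ^ 2) z := by
    intro z hz
    refine ((hasDerivAt_id z).div (dlin z) (hne z hz)).congr_deriv ?_
    simp
  have dq : ∀ z ∈ unitDisc, HasDerivAt
      (fun z : ℂ => (1 + b) / (1 - b) * (z / (1 - z * a) ^ 2))
      ((1 + b) / (1 - b) * ((1 + z * a) / (1 - z * a) ^ 3) : ℂ) z := by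
    intro z hz
    have h1 := hne z hz
    refine (((hasDerivAt_id z).div ((dlin z).pow 2) (pow_ne_zero 2 h1)).const_mul
      ((1 + b) / (1 - b) : ℂ)).congr_deriv ?_
    simp only [id, Pi.pow_apply]
    push_cast
    field_simp
    ring
  refine isOpen_unitDisc.eqOn_of_deriv_eq (convex_ball (0 : ℂ) 1).isPreconnected
    (H.analytic_h.add (H.analytic_g.const_mul _))
    (fun z hz => (dq z hz).differentiableAt.differentiableWithinAt) (fun z hz => ?_)
    (show (0 : ℂ) ∈ unitDisc by simp) (by simp [H.h_zero, H.g_zero])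
  have hn := isOpen_unitDisc.mem_nhds hz
  have h1 := ((H.analytic_h.differentiableAt hn).hasDerivAt.add
    ((H.analytic_g.differentiableAt hn).hasDerivAt.const_mul (a ^ 2)⁻¹)).deriv
  rw [(dq z hz).deriv]
  refine Eq.trans h1 ?_
  have h2 := IsShear.deriv_eq H hz
  rw [(dk z hz).deriv, ← ha] at h2
  have h3 := H.dilatation z hz
  simp only [exp_two_mul_mul_I, ← ha] at h3
  have h4 := hne z hz
  have h5 := hne2 z hz
  rw [h3] at h2 ⊢
  generalize hD : 1 + b * z * a = D at h2 h5 ⊢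
  generalize hE : 1 - z * a = E at h2 h4 ⊢
  -- One minus the normalized dilatation is (1 - b)(1 - za)/(1 + bza), which yields the closed form
  -- of h'.
  have h7 : D - (b + z * a) = (1 - b) * E := by rw [← hD, ← hE]; ring
  have h6 : deriv h z = D / ((1 - b) * E ^ 3) := by
    rw [eq_div_iff (mul_ne_zero hb' (pow_ne_zero 3 h4))]
    have h8 : deriv h z * (D - (b + z * a)) * E ^ 2 = D := by
      have h9 : deriv h z - (a ^ 2)⁻¹ * (a ^ 2 * ((b + z * a) / D) * deriv h z)
          = deriv h z * (D - (b + z * a)) / D := by field_simp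
      rw [h9, div_eq_div_iff h5 (pow_ne_zero 2 h4), one_mul] at h2
      exact h2
    rw [h7] at h8
    rw [← h8]
    ring
  have h10 : D + (b + z * a) = (1 + b) * (1 + z * a) := by rw [← hD]; ring
  rw [h6]
  field_simp
  linear_combination h10

lemma IsFMap.taylorCoeff_eq {b α : ℝ} {h g : ℂ → ℂ} (hb : -1 < b) (hb1 : b < 1)
    (H : IsFMap b α h g) {m : ℕ} (hm : m ≠ 0) :
    taylorCoeff h m = ((1 - b : ℝ) : ℂ)⁻¹ * (exp (α * I))⁻¹ * exp (α * I) ^ m *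
        ((((1 + b) / 2 : ℝ) : ℂ) * m + ((1 - (1 + b) / 2 : ℝ) : ℂ)) ∧
      taylorCoeff g m = ((1 - b : ℝ) : ℂ)⁻¹ * exp (α * I) * exp (α * I) ^ m *
        ((((1 + b) / 2 : ℝ) : ℂ) * m + -((1 - (1 + b) / 2 : ℝ) : ℂ)) := by
  have hq : ∀ z ∈ unitDisc, h z + (exp (α * I) ^ 2)⁻¹ * g z
      = (1 + b) / (1 - b) * (z / (1 - z * exp (α * I)) ^ 2) := H.add_eq hb hb1
  have hd := H.diff_eq
  simp only [exp_neg_two_mul_mul_I] at hd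
  set a := exp (α * I) with ha
  have ha0 : a ≠ 0 := exp_ne_zero _
  have hb' : (1 - b : ℂ) ≠ 0 := by
    have : (1 - b : ℝ) ≠ 0 := by linarith
    exact_mod_cast this
  have hsum : ∀ z ∈ unitDisc, ∀ ε : ℂ, HasSum
      (fun m : ℕ => (a⁻¹ / 2 * ((1 + b) / (1 - b) * (m * a ^ m) +
        ε * (a ^ m - if m = 0 then 1 else 0))) * z ^ m)
      (((1 + b) / (1 - b) * (z / (1 - z * a) ^ 2) + ε * (z / (1 - z * a))) / 2) := by
    intro z hz ε
    have h1 := (((hasSum_koebe (norm_mul_exp_lt hz α)).mul_left ((1 + b) / (1 - b) : ℂ)).add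
      ((hasSum_half_plane (norm_mul_exp_lt hz α)).mul_left ε)).mul_left (a⁻¹ / 2)
    rw [← ha] at h1
    have e : a⁻¹ / 2 * ((1 + b) / (1 - b) * (a * (z / (1 - z * a) ^ 2)) +
        ε * (a * (z / (1 - z * a)))) =
        (((1 + b) / (1 - b) * (z / (1 - z * a) ^ 2) + ε * (z / (1 - z * a))) / 2) := by
      field_simp
    rw [e] at h1
    refine h1.congr_fun fun m => ?_
    ring
  constructor
  · rw [taylorCoeff_of_hasSum (f := h)
      (a := fun m => a⁻¹ / 2 * ((1 + b) / (1 - b) * (m * a ^ m) +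
        1 * (a ^ m - if m = 0 then 1 else 0))) (fun z hz => ?_) m]
    rotate_left
    · have e : h z = ((1 + b) / (1 - b) * (z / (1 - z * a) ^ 2) + 1 * (z / (1 - z * a))) / 2 := by
        rw [← hq z hz, ← hd z hz]; ring
      rw [e]
      exact hsum z hz 1
    · simp only [if_neg hm]
      push_cast
      field_simp
      ring
  · rw [taylorCoeff_of_hasSum (f := g)
      (a := fun m => a ^ 2 * (a⁻¹ / 2 * ((1 + b) / (1 - b) * (m * a ^ m) +
        (-1) * (a ^ m - if m = 0 then 1 else 0)))) (fun z hz => ?_) m]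
    rotate_left
    · have e : g z = a ^ 2 *
          (((1 + b) / (1 - b) * (z / (1 - z * a) ^ 2) + (-1) * (z / (1 - z * a))) / 2) := by
        rw [← hq z hz, ← hd z hz]; field_simp; ring
      rw [e]
      simpa only [mul_assoc] using (hsum z hz (-1)).mul_left (a ^ 2)
    · simp only [if_neg hm]
      push_cast
      field_simp
      ring

/-- The parts of the convolution with `f_{b,α}` are first order differential operators. -/
lemma IsFMap.hadamardProd_eq {b α : ℝ} {h g r s : ℂ → ℂ} (hb : -1 < b) (hb1 : b < 1)
    (H : IsFMap b α h g) (hr : DifferentiableOn ℂ r unitDisc) (hr0 : r 0 = 0)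
    (hs : DifferentiableOn ℂ s unitDisc) (hs0 : s 0 = 0) {z : ℂ} (hz : z ∈ unitDisc) :
    ((1 - b : ℝ) : ℂ) * hadamardProd h r z
        = (exp (α * I))⁻¹ * convH ((1 + b) / 2) r (z * exp (α * I)) ∧
      ((1 - b : ℝ) : ℂ) * hadamardProd g s z
        = exp (α * I) * convG ((1 + b) / 2) s (z * exp (α * I)) := by
  have ha := norm_exp_ofReal_mul_I α
  have hb' : ((1 - b : ℝ) : ℂ) ≠ 0 := ofReal_ne_zero.2 (by linarith)
  rw [_root_.hadamardProd_eq hr hr0 ha (fun m hm => (H.taylorCoeff_eq hb hb1 hm).1) hz,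
    _root_.hadamardProd_eq hs hs0 ha (fun m hm => (H.taylorCoeff_eq hb hb1 hm).2) hz, convH, convG,
    mul_assoc _⁻¹ (exp (α * I))⁻¹, mul_assoc _⁻¹ (exp (α * I)), mul_inv_cancel_left₀ hb',
    mul_inv_cancel_left₀ hb']
  push_cast
  exact ⟨by ring, by ring⟩

/-! ### Rotations and assembly of the theorem. -/

lemma hasDerivAt_const_mul_comp_mul {f : ℂ → ℂ} (hf : DifferentiableOn ℂ f unitDisc) (A : ℂ)
    {B v : ℂ} (hv : v * B ∈ unitDisc) :
    HasDerivAt (fun v => A * f (v * B)) (A * (deriv f (v * B) * B)) v := by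
  have h1 := (hf.differentiableAt (isOpen_unitDisc.mem_nhds hv)).hasDerivAt
  have h2 : HasDerivAt (fun v : ℂ => v * B) B v := by simpa using (hasDerivAt_id v).mul_const B
  exact (h1.comp v h2).const_mul A

lemma mul_mem_unitDisc {v B : ℂ} (hB : ‖B‖ = 1) (hv : v ∈ unitDisc) : v * B ∈ unitDisc := by
  rw [mem_unitDisc, norm_mul, hB, mul_one]; exact mem_unitDisc.1 hv

lemma one_add_mul_exp_ne_zero {z : ℂ} (hz : z ∈ unitDisc) (t : ℝ) : 1 + z * exp (t * I) ≠ 0 := by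
  intro h
  have h1 := norm_mul_exp_lt hz t
  rw [eq_neg_of_add_eq_zero_right h] at h1
  simp at h1

/-- Cancelling z says nothing at z = 0, where the value follows by continuity of both sides. -/
lemma deriv_eq_of_mul_deriv_eq {f : ℂ → ℂ} {η γ : ℝ} (hf : DifferentiableOn ℂ f unitDisc)
    (h : ∀ z ∈ unitDisc, z * deriv f z =
      z / ((1 + z * exp ((η + γ) * I)) * (1 + z * exp (-(η - γ) * I))))
    {z : ℂ} (hz : z ∈ unitDisc) :
    deriv f z = 1 / ((1 + z * exp ((η + γ) * I)) * (1 + z * exp (-(η - γ) * I))) := by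
  have hne : ∀ z ∈ unitDisc, z ≠ 0 →
      deriv f z = 1 / ((1 + z * exp ((η + γ) * I)) * (1 + z * exp (-(η - γ) * I))) := by
    intro z hz h0
    refine mul_left_cancel₀ h0 ?_
    rw [h z hz, mul_one_div]
  rcases eq_or_ne z 0 with rfl | h0
  · have hn := isOpen_unitDisc.mem_nhds hz
    have c1 : ContinuousAt (deriv f) 0 :=
      ((hf.deriv isOpen_unitDisc).differentiableAt hn).continuousAt
    have c2 : ContinuousAt (fun z : ℂ =>
        1 / ((1 + z * exp ((η + γ) * I)) * (1 + z * exp (-(η - γ) * I)))) 0 := by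
      refine ContinuousAt.div (by fun_prop) (by fun_prop) (by simp)
    refine tendsto_nhds_unique (l := 𝓝[≠] (0 : ℂ)) (c1.tendsto.mono_left nhdsWithin_le_nhds)
      ((c2.tendsto.mono_left nhdsWithin_le_nhds).congr' ?_)
    filter_upwards [self_mem_nhdsWithin, mem_nhdsWithin_of_mem_nhds hn] with y hy0 hy
    exact (hne y hy hy0).symm
  · exact hne z hz h0

lemma one_add_mul_exp_mul_one_add_mul_exp (η γ : ℝ) (v : ℂ) :
    (1 + v * (exp (γ * I))⁻¹ * exp ((η + γ) * I)) *
      (1 + v * (exp (γ * I))⁻¹ * exp (-(η - γ) * I)) = 1 + 2 * (Real.cos η : ℝ) * v + v ^ 2 := by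
  have h1 : (exp (γ * I))⁻¹ * exp ((η + γ) * I) = exp (η * I) := by
    rw [← exp_neg, ← exp_add]; ring_nf
  have h2 : (exp (γ * I))⁻¹ * exp (-(η - γ) * I) = exp (-η * I) := by
    rw [← exp_neg, ← exp_add]; ring_nf
  have h3 : exp (η * I) * exp (-η * I) = 1 := by rw [← exp_add]; ring_nf; simp
  rw [mul_assoc v, mul_assoc v, h1, h2, ofReal_cos, Complex.two_cos]
  linear_combination v ^ 2 * h3

/-- Rotation of a shear in direction `-γ` to the direction of the real axis. -/
lemma IsShear.isStripShear {η γ θ : ℝ} {n : ℕ} (hn : 1 ≤ n) {r s f : ℂ → ℂ}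
    (H : IsShear r s γ f (fun z => exp (θ * I) * z ^ n))
    (hf : ∀ z ∈ unitDisc,
      deriv f z = 1 / ((1 + z * exp ((η + γ) * I)) * (1 + z * exp (-(η - γ) * I)))) :
    IsStripShear η n (exp (θ * I) * (exp (γ * I) ^ 2)⁻¹ * (exp (γ * I) ^ n)⁻¹)
      (fun v => exp (γ * I) * r (v * (exp (γ * I))⁻¹))
      (fun v => (exp (γ * I))⁻¹ * s (v * (exp (γ * I))⁻¹)) := by
  have hd := fun z hz => IsShear.deriv_eq H (z := z) hz
  have hE := one_add_mul_exp_mul_one_add_mul_exp η γ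
  have he1 := norm_exp_ofReal_mul_I γ
  have hdil := H.dilatation
  have he0 : exp (γ * I) ≠ 0 := exp_ne_zero _
  generalize hg : exp (γ * I) = e at *
  have he2 : ‖e⁻¹‖ = 1 := by rw [norm_inv, he1, inv_one]
  have hm : ∀ v ∈ unitDisc, v * e⁻¹ ∈ unitDisc := fun v hv => mul_mem_unitDisc he2 hv
  have dR := fun v hv => (hasDerivAt_const_mul_comp_mul H.analytic_h e (hm v hv))
  have dS := fun v hv => (hasDerivAt_const_mul_comp_mul H.analytic_g e⁻¹ (hm v hv))
  refine ⟨hn, ?_, fun v hv => (dR v hv).differentiableAt.differentiableWithinAt,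
    fun v hv => (dS v hv).differentiableAt.differentiableWithinAt, fun v hv => ?_, fun v hv => ?_⟩
  · rw [norm_mul, norm_mul, norm_exp_ofReal_mul_I, norm_inv, norm_inv, norm_pow, norm_pow, he1]
    simp
  · rw [(dR v hv).deriv, (dS v hv).deriv, ← hE v, ← hf _ (hm v hv), ← hd _ (hm v hv)]
    field_simp
  · rw [(dR v hv).deriv, (dS v hv).deriv, hdil _ (hm v hv), mul_pow, inv_pow]
    field_simp

lemma SetConvexInDirection.image_mul {E : Set ℂ} (hE : SetConvexInDirection E 0) {ρ ψ : ℝ}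
    (hρ : ρ ≠ 0) : SetConvexInDirection ((fun w => ρ * exp (ψ * I) * w) '' E) ψ := by
  intro p
  have hρ' : (ρ : ℂ) ≠ 0 := ofReal_ne_zero.2 hρ
  have he := exp_ne_zero (ψ * I)
  have h := (hE (p / (ρ * exp (ψ * I)))).image (fun w => ρ * exp (ψ * I) * w)
    (by fun_prop)
  convert h using 1
  ext z
  simp only [ofReal_zero, zero_mul, exp_zero, mul_one]
  constructor
  · rintro ⟨⟨w, hw, rfl⟩, t, ht⟩
    refine ⟨w, ⟨hw, t / ρ, ?_⟩, rfl⟩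
    simp only at ht
    refine mul_left_cancel₀ (mul_ne_zero hρ' he) ?_
    rw [ht]
    push_cast
    field_simp
  · rintro ⟨w, ⟨hw, t, rfl⟩, rfl⟩
    refine ⟨⟨_, hw, rfl⟩, ρ * t, ?_⟩
    push_cast
    field_simp

lemma harmonicOnNhd_harmonicSum {H G : ℂ → ℂ} (hH : DifferentiableOn ℂ H unitDisc)
    (hG : DifferentiableOn ℂ G unitDisc) : HarmonicOnNhd (harmonicSum H G) unitDisc := by
  intro z hz
  have hn := isOpen_unitDisc.mem_nhds hz
  exact (hH.analyticAt hn).harmonicAt.add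
    ((harmonicAt_comp_CLE_iff conjCLE).2 (hG.analyticAt hn).harmonicAt)

theorem harmonicConv_isNormalizedUnivalentHarmonic {n : ℕ} {b α γ η θ : ℝ} {h g r s : ℂ → ℂ}
    (hn : 1 ≤ n) (hb : -1 < b) (hbn : b ≤ -((n : ℝ) - 2) / ((n : ℝ) + 2))
    (HF : IsFMap b α h g) (HT : IsTMap η γ θ n r s) :
    (∃ H G : ℂ → ℂ, IsNormalizedUnivalentHarmonic
      (fun z => ((1 - b : ℝ) : ℂ) * harmonicConv h g r s z) H G ∧ deriv G 0 = 0) ∧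
    ConvexInDirection (harmonicConv h g r s) (-(α + γ)) := by
  obtain ⟨f, hf, hzf, HS⟩ := HT
  have hn' : (1 : ℝ) ≤ n := by exact_mod_cast hn
  rw [le_div_iff₀ (by positivity)] at hbn
  have hb1 : b < 1 := by nlinarith
  set β : ℝ := (1 + b) / 2 with hβ
  have hβ0 : 0 < β := by linarith
  have hβ1 : β < 1 := by linarith
  -- This is the upper bound on b, i.e. k = 1 - β(1 + n/2) ≥ 0.
  have hβn : β * (n + 2) ≤ 2 := by rw [hβ]; linarith
  have K := HS.isStripShear hn (fun z hz => deriv_eq_of_mul_deriv_eq hf hzf hz)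
  set c := exp (θ * I) * (exp (γ * I) ^ 2)⁻¹ * (exp (γ * I) ^ n)⁻¹
  set R : ℂ → ℂ := fun v => exp (γ * I) * r (v * (exp (γ * I))⁻¹) with hR
  set S : ℂ → ℂ := fun v => (exp (γ * I))⁻¹ * s (v * (exp (γ * I))⁻¹) with hS
  have he : exp (γ * I) ≠ 0 := exp_ne_zero _
  have he1 : ‖(exp (γ * I))⁻¹‖ = 1 := by rw [norm_inv, norm_exp_ofReal_mul_I, inv_one]
  set E := exp (α * I) * exp (γ * I) with hE
  have hE1 : ‖E‖ = 1 := by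
    rw [hE, norm_mul, norm_exp_ofReal_mul_I, norm_exp_ofReal_mul_I, mul_one]
  have hE0 : E ≠ 0 := mul_ne_zero (exp_ne_zero _) he
  have hEc : conj E = E⁻¹ := (inv_eq_conj hE1).symm
  have hEm : ∀ z ∈ unitDisc, z * E ∈ unitDisc := fun z hz => mul_mem_unitDisc hE1 hz
  have hRH : ∀ v ∈ unitDisc, convH β R v = exp (γ * I) * convH β r (v * (exp (γ * I))⁻¹) := by
    intro v hv
    rw [convH, convH, (hasDerivAt_const_mul_comp_mul HS.analytic_h _
      (mul_mem_unitDisc he1 hv)).deriv]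
    ring
  have hSG : ∀ v ∈ unitDisc, convG β S v = (exp (γ * I))⁻¹ * convG β s (v * (exp (γ * I))⁻¹) := by
    intro v hv
    rw [convG, convG, (hasDerivAt_const_mul_comp_mul HS.analytic_g _
      (mul_mem_unitDisc he1 hv)).deriv]
    ring
  set H : ℂ → ℂ := fun z => E⁻¹ * convH β R (z * E) with hHdef
  set G : ℂ → ℂ := fun z => E * convG β S (z * E) with hGdef
  have hdH : ∀ z ∈ unitDisc, HasDerivAt H (deriv (convH β R) (z * E)) z := fun z hz => by
    refine (hasDerivAt_const_mul_comp_mul (K.differentiableOn_convH β) E⁻¹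
      (hEm z hz)).congr_deriv ?_
    field_simp
  have hdG : ∀ z ∈ unitDisc, HasDerivAt G (E ^ 2 * deriv (convG β S) (z * E)) z := fun z hz => by
    refine (hasDerivAt_const_mul_comp_mul (K.differentiableOn_convG β) E
      (hEm z hz)).congr_deriv ?_
    ring
  have hHd : DifferentiableOn ℂ H unitDisc := fun z hz =>
    (hdH z hz).differentiableAt.differentiableWithinAt
  have hGd : DifferentiableOn ℂ G unitDisc := fun z hz =>
    (hdG z hz).differentiableAt.differentiableWithinAt
  have hrep : EqOn (fun z => ((1 - b : ℝ) : ℂ) * harmonicConv h g r s z) (harmonicSum H G)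
      unitDisc := by
    intro z hz
    obtain ⟨h1, h2⟩ := HF.hadamardProd_eq hb hb1 HS.analytic_h HS.h_zero HS.analytic_g HS.g_zero hz
    have e : z * E * (exp (γ * I))⁻¹ = z * exp (α * I) := by rw [hE]; field_simp
    rw [← hβ] at h1 h2
    simp only [harmonicConv, harmonicSum, hHdef, hGdef]
    rw [hRH _ (hEm z hz), hSG _ (hEm z hz), e, mul_add, h1, ← conj_ofReal (1 - b), ← map_mul, h2,
      hE, mul_inv, mul_assoc _ (exp (γ * I))⁻¹, inv_mul_cancel_left₀ he,
      mul_assoc (exp (α * I)) (exp (γ * I)), mul_inv_cancel_left₀ he]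
  -- Since conj E = E⁻¹, the two parts rotate together; the outer factor E⁻¹ turns the real
  -- direction into -(α + γ).
  have hrot : ∀ z, harmonicSum H G z = E⁻¹ * harmonicSum (convH β R) (convG β S) (z * E) := by
    intro z
    simp only [harmonicSum, hHdef, hGdef, map_mul, hEc]
    ring
  have h0 : (0 : ℂ) ∈ unitDisc := by simp
  obtain ⟨P, hP, hP1, hP2⟩ := K.exists_hasDerivAt_conv β h0
  have hn0 : n ≠ 0 := by omega
  have hR0 : deriv R 0 = 1 := by
    rw [K.deriv_R_eq h0]
    simp [hn0]
  refine ⟨⟨H, G, ?_, ?_⟩, ?_⟩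
  · refine ⟨fun z hz => ?_, fun z hz w hw hzw => ?_, hHd, hGd, hrep, ?_, ?_, ?_, fun z hz => ?_⟩
    · refine (harmonicAt_congr_nhds (hrep.eventuallyEq_of_mem (isOpen_unitDisc.mem_nhds hz))).2
        (harmonicOnNhd_harmonicSum hHd hGd z hz)
    · replace hzw : harmonicSum H G z = harmonicSum H G w := by
        rw [← hrep hz, ← hrep hw]; exact hzw
      rw [hrot, hrot] at hzw
      exact mul_right_cancel₀ hE0 ((K.injOn_and_isPreconnected hβ0 hβ1 hβn).1 (hEm z hz) (hEm w hw)
        (mul_left_cancel₀ (inv_ne_zero hE0) hzw))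
    · simp [hHdef, convH, hR, HS.h_zero]
    · simp [hGdef, convG, hS, HS.g_zero]
    -- At 0 one has P = 1 + n/2, so k + βP = 1: the factor 1 - b is the right normalization.
    · rw [(hdH 0 h0).deriv, zero_mul, hP1.deriv, hR0, hP]
      simp [hn0]
    · rw [(hdH z hz).deriv, (hdG z hz).deriv, norm_mul, norm_pow, hE1, one_pow, one_mul, sub_pos]
      have := K.norm_deriv_convG_lt hβ0 hβn (hEm z hz)
      gcongr
  · rw [(hdG 0 h0).deriv, zero_mul, hP2.deriv]
    simp [hn0]
  · have hb2 : (1 - b) ≠ 0 := by linarith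
    have hb3 : ((1 - b : ℝ) : ℂ) ≠ 0 := ofReal_ne_zero.2 hb2
    have h1 := (K.convexInDirection hβ0 hβ1 hβn).image_mul (ψ := -(α + γ)) (inv_ne_zero hb2)
    rw [ConvexInDirection]
    convert h1 using 1
    have hexp : exp (((-(α + γ) : ℝ) : ℂ) * I) = E⁻¹ := by
      rw [hE, ← exp_add, ← exp_neg]; push_cast; ring_nf
    have hval : ∀ z ∈ unitDisc, harmonicConv h g r s z =
        (((1 - b)⁻¹ : ℝ) : ℂ) * exp (((-(α + γ) : ℝ) : ℂ) * I) *
          harmonicSum (convH β R) (convG β S) (z * E) := by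
      intro z hz
      rw [hexp, mul_assoc, ← hrot, ← hrep hz, ofReal_inv, inv_mul_cancel_left₀ hb3]
    ext w
    constructor
    · rintro ⟨z, hz, rfl⟩
      exact ⟨_, ⟨z * E, hEm z hz, rfl⟩, (hval z hz).symm⟩
    · rintro ⟨_, ⟨v, hv, rfl⟩, rfl⟩
      have hv' : v * E⁻¹ ∈ unitDisc := mul_mem_unitDisc (by rw [norm_inv, hE1, inv_one]) hv
      refine ⟨v * E⁻¹, hv', ?_⟩
      rw [hval _ hv', inv_mul_cancel_right₀ hE0]

/-- The derivative of the conformal map onto a vertical strip. -/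
lemma hasDerivAt_strip_log {ψ : ℝ} (hψ : Real.sin ψ ≠ 0) {z : ℂ} (hz : z ∈ unitDisc) :
    HasDerivAt (fun z : ℂ => 1 / (2 * I * Real.sin ψ) *
        log ((1 + z * exp (ψ * I)) / (1 + z * exp (-ψ * I))))
      (1 / ((1 + z * exp (ψ * I)) * (1 + z * exp (-ψ * I)))) z := by
  have hA := one_add_mul_exp_ne_zero hz ψ
  have hB := one_add_mul_exp_ne_zero hz (-ψ)
  rw [ofReal_neg] at hB
  have hre : ∀ t : ℝ, 0 < (1 + z * exp (t * I)).re := by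
    intro t
    have := (abs_lt.1 ((abs_re_le_norm _).trans_lt (norm_mul_exp_lt hz t))).1
    rw [add_re, one_re]
    linarith
  have hslit : (1 + z * exp (ψ * I)) / (1 + z * exp (-ψ * I)) ∈ slitPlane := by
    rw [mem_slitPlane_iff_not_le_zero]
    intro hle
    obtain ⟨t, ht⟩ : ∃ t : ℝ, (t : ℂ) = (1 + z * exp (ψ * I)) / (1 + z * exp (-ψ * I)) := by
      refine ⟨((1 + z * exp (ψ * I)) / (1 + z * exp (-ψ * I))).re, ?_⟩
      have := (le_def.1 hle).2
      exact Complex.ext (ofReal_re _) (by rw [ofReal_im, this, zero_im])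
    rw [← ht] at hle
    have ht0 : t ≤ 0 := by exact_mod_cast hle
    rw [eq_div_iff hB] at ht
    have h1 := congrArg re ht
    rw [re_ofReal_mul] at h1
    have h2 := hre (-ψ)
    rw [ofReal_neg] at h2
    nlinarith [hre ψ]
  have hs : (Real.sin ψ : ℂ) ≠ 0 := ofReal_ne_zero.2 hψ
  have dlin : ∀ a : ℂ, HasDerivAt (fun z : ℂ => 1 + z * a) a z := fun a => by
    simpa using ((hasDerivAt_id z).mul_const a).const_add 1
  refine ((((dlin _).div (dlin _) hB).clog hslit).const_mul
    (1 / (2 * I * Real.sin ψ) : ℂ)).congr_deriv ?_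
  have h2 : exp (ψ * I) - exp (-ψ * I) = 2 * I * Real.sin ψ := by
    rw [ofReal_sin, Complex.sin]
    linear_combination (exp (ψ * I) - exp (-ψ * I)) * I_sq
  simp only [Pi.div_apply]
  have h3 : exp (ψ * I) * (1 + z * exp (-ψ * I)) - (1 + z * exp (ψ * I)) * exp (-ψ * I)
      = 2 * I * Real.sin ψ := by rw [← h2]; ring
  rw [h3]
  generalize 1 + z * exp (ψ * I) = A at *
  generalize 1 + z * exp (-ψ * I) = B at *
  have hI := I_ne_zero
  field_simp

theorem theorem3p2 :
    (∀ (n : ℕ) (b α γ η θ : ℝ) (h g r s : ℂ → ℂ),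
      1 ≤ n → -1 < b → b ≤ -((n : ℝ) - 2) / ((n : ℝ) + 2) →
      IsFMap b α h g → IsTMap η γ θ n r s →
        (fun z => ((1 - b : ℝ) : ℂ) * harmonicConv h g r s z) ∈ classSH ∧
        ConvexInDirection (harmonicConv h g r s) (-(α + γ))) ∧
    -- the special case of the strip mappings
    (∀ (n : ℕ) (ψ θ : ℝ) (h g r s : ℂ → ℂ),
      (n = 1 ∨ n = 2) → Real.pi / 2 ≤ ψ → ψ < Real.pi →
      IsShear h g 0 (fun z => z / (1 - z)) (fun z => z) →
      IsShear r s 0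
        (fun z => 1 / (2 * I * Real.sin ψ) *
          log ((1 + z * exp (ψ * I)) / (1 + z * exp (-ψ * I))))
        (fun z => exp (θ * I) * z ^ n) →
        harmonicConv h g r s ∈ classSHZero ∧
        ConvexInDirection (harmonicConv h g r s) 0) := by
  refine ⟨fun n b α γ η θ h g r s hn hb hbn HF HT => ?_, fun n ψ θ h g r s hn hψ hψ' HF HS => ?_⟩
  · obtain ⟨⟨H, G, hHG, -⟩, hconv⟩ :=
      harmonicConv_isNormalizedUnivalentHarmonic hn hb hbn HF HT
    exact ⟨⟨H, G, hHG⟩, hconv⟩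
  · have hsin : Real.sin ψ ≠ 0 :=
      (Real.sin_pos_of_pos_of_lt_pi (by linarith [Real.pi_pos]) hψ').ne'
    -- The special case is b = α = γ = 0, η = ψ; the value b = 0 is admissible exactly when n ≤ 2.
    have HF' : IsFMap 0 0 h g := by
      simpa [IsFMap] using HF
    have HT' : IsTMap ψ 0 θ n r s := by
      refine ⟨_, fun z hz => (hasDerivAt_strip_log hsin hz).differentiableAt.differentiableWithinAt,
        fun z hz => ?_, HS⟩
      rw [(hasDerivAt_strip_log hsin hz).deriv, mul_one_div]
      simp
    have hn1 : 1 ≤ n := by omega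
    have hbn : (0 : ℝ) ≤ -((n : ℝ) - 2) / ((n : ℝ) + 2) := by
      rcases hn with rfl | rfl <;> norm_num
    obtain ⟨⟨H, G, hHG, hG0⟩, hconv⟩ :=
      harmonicConv_isNormalizedUnivalentHarmonic hn1 (by norm_num) hbn HF' HT'
    simp only [sub_zero, ofReal_one, one_mul, add_zero, neg_zero] at hHG hconv
    exact ⟨⟨H, G, hHG, hG0⟩, hconv⟩
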